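/- Let $\mathbb{C}_+=\{w\in\mathbb{C}:\mathrm{Re}(w)>0\}$, and let $H^2(\mathbb{C}_+)$ be the Hardy space of analytic functions $f$ on $\mathbb{C}_+$ with \[ \|f\|=\Big(\sup_{0<x<\infty}\int_{-\infty}^{\infty}|f(x+iy)|^2\,dy\Big)^{1/2}<\infty . \] A bounded linear operator $U$ on a Banach space $\mathcal{B}$ is called universal for $\mathcal{B}$ if for every bounded linear operator $T$ on $\mathcal{B}$ there are a constant $\alpha\neq 0$ and a closed subspace $\mathcal{M}\subset\mathcal{B}$ with $U\mathcal{M}\subset\mathcal{M}$ such that the restriction $U|_{\mathcal{M}}$ is similar to $\alpha T$, i.e. $U|_{\mathcal{M}}\,S=S\,(\alpha T)$ for some linear homeomorphism $S:\mathcal{B}\to\mathcal{M}$. \textbf{Theorem.} Let $a\in(0,1)\cup(1,\infty)$, let $b\in\mathbb{C}$ with $\mathrm{Re}(b)>0$, and put $\psi(w)=aw+b$ for $w\in\mathbb{C}_+$. Let $C_\psi$ be the (bounded) composition operator $C_\psi f=f\circ\psi$ on $H^2(\mathbb{C}_+)$. Write $\sigma$ for the spectrum and $\sigma_p$ for the point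 spectrum (the set of eigenvalues). \begin{enumerate} \item If $a>1$, then $C_\psi-\lambda I$ is universal for $H^2(\mathbb{C}_+)$ for every $\lambda\in\mathbb{C}$ with $0<|\lambda|<a^{-1/2}$, and $\{\lambda\in\mathbb{C}:0<|\lambda|<a^{-1/2}\}\subset\sigma_p(C_\psi)$. \item If $a<1$, then $C_\psi-\lambda I$ is not universal for $H^2(\mathbb{C}_+)$ for any $\lambda\in\mathbb{C}$, and $\sigma_p(C_\psi)=\emptyset$. \item In both cases $\sigma(C_\psi)=\{\lambda\in\mathbb{C}:|\lambda|\le a^{-1/2}\}$. \end{enumerate} -/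

import Mathlib

open MeasureTheory
open scoped ENNReal

/-- The open right half-plane `ℂ₊`. -/
def rightHalfPlane : Set ℂ := {w : ℂ | 0 < w.re}

namespace HardyH2

/-- The quantity `(sup_{0 < x < ∞} ∫_ℝ |f (x + i y)|² dy) ^ (1/2)`, with values in `[0, ∞]`. -/
noncomputable def hardyENorm (f : ℂ → ℂ) : ℝ≥0∞ :=
  (⨆ x : {x : ℝ // 0 < x}, ∫⁻ y : ℝ, ‖f (((x : ℝ) : ℂ) + (y : ℂ) * Complex.I)‖ₑ ^ 2) ^ (1 / 2 : ℝ)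

/-- The restriction of `f` to the vertical line `Re w = x`. -/
noncomputable def vert (f : ℂ → ℂ) (x : ℝ) : ℝ → ℂ := fun y => f ((x : ℂ) + (y : ℂ) * Complex.I)

theorem hardyENorm_eq (f : ℂ → ℂ) :
    hardyENorm f = ⨆ x : {x : ℝ // 0 < x}, eLpNorm (vert f x) 2 volume := by
  have h : ∀ x : ℝ, eLpNorm (vert f x) 2 volume =
      (ENNReal.orderIsoRpow (1 / 2 : ℝ) (by norm_num))
        (∫⁻ y : ℝ, ‖f ((x : ℂ) + (y : ℂ) * Complex.I)‖ₑ ^ 2) := by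
    intro x
    rw [eLpNorm_eq_lintegral_rpow_enorm_toReal (by norm_num) (by norm_num)]
    simp [vert, ENNReal.orderIsoRpow_apply]
  simp_rw [h]
  rw [← OrderIso.map_iSup, ENNReal.orderIsoRpow_apply, hardyENorm]

theorem continuous_vert {f : ℂ → ℂ} (hf : DifferentiableOn ℂ f rightHalfPlane) {x : ℝ}
    (hx : 0 < x) : Continuous (vert f x) := by
  refine hf.continuousOn.comp_continuous (by fun_prop) (fun y => ?_)
  simpa [rightHalfPlane] using hx

theorem hardyENorm_zero : hardyENorm 0 = 0 := by
  rw [hardyENorm_eq]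
  have : ∀ x : ℝ, vert 0 x = 0 := fun x => rfl
  simp [this]

theorem hardyENorm_smul (c : ℂ) (f : ℂ → ℂ) : hardyENorm (c • f) = ‖c‖ₑ * hardyENorm f := by
  have : ∀ x : ℝ, vert (c • f) x = c • vert f x := fun x => rfl
  simp_rw [hardyENorm_eq, this, eLpNorm_const_smul, ENNReal.mul_iSup]

theorem hardyENorm_add_le {f g : ℂ → ℂ} (hf : DifferentiableOn ℂ f rightHalfPlane)
    (hg : DifferentiableOn ℂ g rightHalfPlane) :
    hardyENorm (f + g) ≤ hardyENorm f + hardyENorm g := by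
  have : ∀ x : ℝ, vert (f + g) x = vert f x + vert g x := fun x => rfl
  simp_rw [hardyENorm_eq, this]
  refine iSup_le fun x => ?_
  refine (eLpNorm_add_le (continuous_vert hf x.2).aestronglyMeasurable
    (continuous_vert hg x.2).aestronglyMeasurable (by norm_num)).trans ?_
  exact add_le_add (le_iSup (fun x : {x : ℝ // 0 < x} => eLpNorm (vert f x) 2 volume) x)
    (le_iSup (fun x : {x : ℝ // 0 < x} => eLpNorm (vert g x) 2 volume) x)

theorem eq_zero_of_hardyENorm {f : ℂ → ℂ} (hf : DifferentiableOn ℂ f rightHalfPlane)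
    (h : hardyENorm f = 0) {w : ℂ} (hw : w ∈ rightHalfPlane) : f w = 0 := by
  have hw' : 0 < w.re := hw
  rw [hardyENorm_eq] at h
  have h1 : eLpNorm (vert f w.re) 2 volume = 0 := by
    rw [← le_zero_iff, ← h]
    exact le_iSup (fun x : {x : ℝ // 0 < x} => eLpNorm (vert f x) 2 volume) ⟨w.re, hw'⟩
  have hc := continuous_vert hf hw'
  rw [eLpNorm_eq_zero_iff hc.aestronglyMeasurable (by norm_num)] at h1
  have h2 : vert f w.re = 0 := (hc.ae_eq_iff_eq volume continuous_zero).1 h1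
  have h3 := congrFun h2 w.im
  simpa [vert, Complex.re_add_im] using h3

/-- The vector space underlying `H²(ℂ₊)`: analytic functions on the open right half-plane whose
Hardy norm is finite. A function on `ℂ₊` is represented by its extension by zero to `ℂ`. -/
def hardySubmodule : Submodule ℂ (ℂ → ℂ) where
  carrier := {f | DifferentiableOn ℂ f rightHalfPlane ∧ (∀ w, w ∉ rightHalfPlane → f w = 0) ∧
    hardyENorm f < ∞}
  zero_mem' := ⟨differentiableOn_const 0, fun _ _ => rfl, by
    rw [hardyENorm_zero]; exact ENNReal.zero_lt_top⟩
  add_mem' := by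
    rintro f g ⟨hf, hf0, hfn⟩ ⟨hg, hg0, hgn⟩
    refine ⟨hf.add hg, fun w hw => by simp [hf0 w hw, hg0 w hw], ?_⟩
    exact (hardyENorm_add_le hf hg).trans_lt (ENNReal.add_lt_top.2 ⟨hfn, hgn⟩)
  smul_mem' := by
    rintro c f ⟨hf, hf0, hfn⟩
    refine ⟨hf.const_smul c, fun w hw => by simp [hf0 w hw], ?_⟩
    rw [hardyENorm_smul]
    exact ENNReal.mul_lt_top enorm_lt_top hfn

end HardyH2

/-- The Hardy space `H²(ℂ₊)` of the open right half-plane. It is a type of its own, so that its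
topology is the norm topology and not that of pointwise convergence. -/
def HardyH2 : Type := HardyH2.hardySubmodule

namespace HardyH2

noncomputable instance : AddCommGroup HardyH2 := inferInstanceAs (AddCommGroup hardySubmodule)

noncomputable instance : Module ℂ HardyH2 := inferInstanceAs (Module ℂ hardySubmodule)

/-- Elements of `H²(ℂ₊)` are functions. -/
instance : CoeFun HardyH2 (fun _ => ℂ → ℂ) := ⟨fun f => f.1⟩

theorem differentiableOn (f : HardyH2) : DifferentiableOn ℂ f rightHalfPlane := f.2.1

theorem apply_of_notMem (f : HardyH2) {w : ℂ} (hw : w ∉ rightHalfPlane) : f w = 0 := f.2.2.1 w hw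

theorem hardyENorm_lt_top (f : HardyH2) : hardyENorm f < ∞ := f.2.2.2

@[ext] theorem ext {f g : HardyH2} (h : ∀ w ∈ rightHalfPlane, f w = g w) : f = g := by
  refine Subtype.ext (funext fun w => ?_)
  by_cases hw : w ∈ rightHalfPlane
  · exact h w hw
  · rw [f.2.2.1 w hw, g.2.2.1 w hw]

/-- The norm `‖f‖ = (sup_{0 < x < ∞} ∫_ℝ |f (x + i y)|² dy) ^ (1/2)` of `H²(ℂ₊)`. -/
noncomputable instance : NormedAddCommGroup HardyH2 :=
  AddGroupNorm.toNormedAddCommGroup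
    { toFun := fun f => (hardyENorm f).toReal
      map_zero' := by
        change (hardyENorm 0).toReal = 0
        rw [hardyENorm_zero]; rfl
      add_le' := fun f g => by
        rw [← ENNReal.toReal_add f.hardyENorm_lt_top.ne g.hardyENorm_lt_top.ne]
        exact ENNReal.toReal_mono
          (ENNReal.add_lt_top.2 ⟨f.hardyENorm_lt_top, g.hardyENorm_lt_top⟩).ne
          (hardyENorm_add_le f.differentiableOn g.differentiableOn)
      neg' := fun f => by
        have h : ((-f : HardyH2) : ℂ → ℂ) = (-1 : ℂ) • (f : ℂ → ℂ) := by
          rw [neg_one_smul]; rfl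
        rw [h, hardyENorm_smul]
        simp
      eq_zero_of_map_eq_zero' := fun f hf => by
        have h0 : hardyENorm f = 0 :=
          ((ENNReal.toReal_eq_zero_iff _).1 hf).resolve_right f.hardyENorm_lt_top.ne
        exact HardyH2.ext fun w hw => eq_zero_of_hardyENorm f.differentiableOn h0 hw }

theorem norm_def (f : HardyH2) : ‖f‖ = (hardyENorm f).toReal := rfl

noncomputable instance : NormedSpace ℂ HardyH2 where
  norm_smul_le c f := by
    change (hardyENorm (c • (f : ℂ → ℂ))).toReal ≤ ‖c‖ * (hardyENorm f).toReal
    rw [hardyENorm_smul, ENNReal.toReal_mul, toReal_enorm]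

open Classical in
/-- The function `f ∘ ψ` on `ℂ₊` (extended by zero to `ℂ`). -/
noncomputable def compFun (ψ f : ℂ → ℂ) : ℂ → ℂ :=
  fun w => if w ∈ rightHalfPlane then f (ψ w) else 0

/-- The affine symbol `ψ(w) = a w + b`. -/
def affineSymbol (a : ℝ) (b : ℂ) : ℂ → ℂ := fun w => (a : ℂ) * w + b

theorem mapsTo_affineSymbol {a : ℝ} {b : ℂ} (ha : 0 < a) (hb : 0 ≤ b.re) :
    Set.MapsTo (affineSymbol a b) rightHalfPlane rightHalfPlane := by
  intro w hw
  have hw' : 0 < w.re := hw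
  have : 0 < a * w.re := mul_pos ha hw'
  simp only [rightHalfPlane, affineSymbol, Set.mem_ofPred_eq, Complex.add_re, Complex.mul_re,
    Complex.ofReal_re, Complex.ofReal_im]
  linarith

theorem hardyENorm_compFun_le {a : ℝ} {b : ℂ} (ha : 0 < a) (hb : 0 ≤ b.re) (f : ℂ → ℂ) :
    hardyENorm (compFun (affineSymbol a b) f) ≤
      ENNReal.ofReal (a⁻¹) ^ (1 / 2 : ℝ) * hardyENorm f := by
  unfold hardyENorm
  rw [← ENNReal.mul_rpow_of_nonneg _ _ (by norm_num)]
  refine ENNReal.rpow_le_rpow (iSup_le fun x => ?_) (by norm_num)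
  have hx := x.2
  have hx' : 0 < a * x + b.re := by
    have := mul_pos ha hx
    linarith
  let g : ℝ → ℝ≥0∞ := fun y =>
    ‖f (((a * x + b.re : ℝ) : ℂ) + (y : ℂ) * Complex.I)‖ₑ ^ 2
  have h1 : ∀ y : ℝ, ‖compFun (affineSymbol a b) f (((x : ℝ) : ℂ) + (y : ℂ) * Complex.I)‖ₑ ^ 2
      = g (a * y + b.im) := by
    intro y
    have hm : (((x : ℝ) : ℂ) + (y : ℂ) * Complex.I) ∈ rightHalfPlane := by
      simpa [rightHalfPlane] using hx
    have he : affineSymbol a b (((x : ℝ) : ℂ) + (y : ℂ) * Complex.I) =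
        ((a * x + b.re : ℝ) : ℂ) + ((a * y + b.im : ℝ) : ℂ) * Complex.I := by
      apply Complex.ext <;> simp [affineSymbol]
    simp only [compFun, if_pos hm, he, g]
  have h2 : ∫⁻ y : ℝ, g (a * y + b.im) = ENNReal.ofReal a⁻¹ * ∫⁻ y : ℝ, g y := by
    let e : ℝ ≃ᵐ ℝ := (Homeomorph.mulLeft₀ a ha.ne').toMeasurableEquiv
    have h3 : ∫⁻ y : ℝ, g (a * y + b.im) =
        ∫⁻ y : ℝ, g (y + b.im) ∂(Measure.map e volume) :=
      (lintegral_map_equiv (fun y => g (y + b.im)) e).symm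
    have h4 : Measure.map e volume = ENNReal.ofReal a⁻¹ • (volume : Measure ℝ) := by
      have := Real.map_volume_mul_left ha.ne'
      rw [abs_of_pos (inv_pos.2 ha)] at this
      exact this
    rw [h3, h4, lintegral_smul_measure, lintegral_add_right_eq_self, smul_eq_mul]
  simp_rw [h1]
  rw [h2]
  gcongr
  exact le_iSup (fun x : {x : ℝ // 0 < x} =>
    ∫⁻ y : ℝ, ‖f (((x : ℝ) : ℂ) + (y : ℂ) * Complex.I)‖ₑ ^ 2) ⟨a * x + b.re, hx'⟩

theorem compFun_mem {a : ℝ} {b : ℂ} (ha : 0 < a) (hb : 0 ≤ b.re) (f : HardyH2) :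
    compFun (affineSymbol a b) f ∈ hardySubmodule := by
  refine ⟨?_, fun w hw => if_neg hw, ?_⟩
  · have hd : DifferentiableOn ℂ (affineSymbol a b) rightHalfPlane := by
      unfold affineSymbol
      fun_prop
    exact (f.differentiableOn.comp hd (mapsTo_affineSymbol ha hb)).congr
      fun w hw => if_pos hw
  · refine (hardyENorm_compFun_le ha hb f).trans_lt (ENNReal.mul_lt_top ?_ f.hardyENorm_lt_top)
    exact ENNReal.rpow_lt_top_of_nonneg (by norm_num) ENNReal.ofReal_ne_top

/-- The composition operator `C_ψ f = f ∘ ψ` on `H²(ℂ₊)`, with `ψ(w) = a w + b`, as a bounded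
linear operator. -/
noncomputable def compOp (a : ℝ) (b : ℂ) (ha : 0 < a) (hb : 0 ≤ b.re) : HardyH2 →L[ℂ] HardyH2 :=
  LinearMap.mkContinuous
    { toFun := fun f => (⟨compFun (affineSymbol a b) f, compFun_mem ha hb f⟩ : hardySubmodule)
      map_add' := fun f g => HardyH2.ext fun w hw => by
        change compFun _ _ w = compFun _ _ w + compFun _ _ w
        simp only [compFun, if_pos hw]
        rfl
      map_smul' := fun c f => HardyH2.ext fun w hw => by
        change compFun _ _ w = c • compFun _ _ w
        simp only [compFun, if_pos hw]
        rfl }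
    (ENNReal.ofReal (a⁻¹) ^ (1 / 2 : ℝ)).toReal
    (fun f => by
      rw [norm_def, norm_def, ← ENNReal.toReal_mul]
      refine ENNReal.toReal_mono (ENNReal.mul_lt_top ?_ f.hardyENorm_lt_top).ne
        (hardyENorm_compFun_le ha hb f)
      exact ENNReal.rpow_lt_top_of_nonneg (by norm_num) ENNReal.ofReal_ne_top)

theorem compOp_apply {a : ℝ} {b : ℂ} (ha : 0 < a) (hb : 0 ≤ b.re) (f : HardyH2) {w : ℂ}
    (hw : w ∈ rightHalfPlane) : compOp a b ha hb f w = f ((a : ℂ) * w + b) :=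
  if_pos hw

end HardyH2

/-- `U` is universal for `E` (in the sense of Rota): for every bounded operator `T` on `E` there
are `α ≠ 0` and a closed invariant subspace `M` of `U` such that `U` restricted to `M` is similar
to `α T`, that is, `U|_M ∘ e = e ∘ (α T)` for a linear homeomorphism `e : E → M`. -/
def IsUniversalOperator {E : Type*} [NormedAddCommGroup E] [NormedSpace ℂ E] (U : E →L[ℂ] E) :
    Prop :=
  ∀ T : E →L[ℂ] E, ∃ α : ℂ, α ≠ 0 ∧ ∃ M : Submodule ℂ E, IsClosed (M : Set E) ∧
    (∀ x ∈ M, U x ∈ M) ∧ ∃ e : E ≃L[ℂ] M, ∀ x : E, U (e x : E) = (e ((α • T) x) : E)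

/-- The point spectrum `σ_p(U)`: the set of eigenvalues of `U`. -/
def pointSpectrum {E : Type*} [NormedAddCommGroup E] [NormedSpace ℂ E] (U : E →L[ℂ] E) : Set ℂ :=
  {μ : ℂ | ∃ x : E, x ≠ 0 ∧ U x = μ • x}

/-!
The theorem is transported to `L²(0, ∞)` by the Paley–Wiener theorem: the Laplace transform
`F ↦ (w ↦ ∫ exp (-2πwt) F t dt)` is an isometric isomorphism `laplaceEquiv` of `L²(0, ∞)` onto
`H²(ℂ₊)`. That it is isometric is Plancherel's theorem on vertical lines. That it is onto rests on
Cauchy's formula on a vertical line (`integral_vert_mul_inv_sub`): with Parseval's identity it shows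
that on `Re w > x` a function in the Hardy space is the Laplace transform of the inverse Fourier
transform of its restriction to the line `Re w = x`.

On `L²(0, ∞)` the composition operator becomes the weighted dilation
`(C F)(s) = a⁻¹ exp (-βs/a) F (s/a)` with `β = 2πb`, whose norm is at most `κ = a^(-1/2)`. On each
orbit `{aⁿ s}` it is a weighted bilateral shift; its weights tend to `κ` as the argument tends to
`0` and decay superexponentially as the argument tends to `∞`.

* If `a > 1`, then `C` shifts mass towards `∞`. Near `0` multiplication by an exponential conjugates
  `C` to the exact dilation `D F = a⁻¹ F (·/a)`, and `D - μ` is invertible for `|μ| < κ`; far from `0`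
  the operator is smaller than `|μ|`, so that `C - μ` is invertible there by a Neumann series.
  Patching the two gives a right inverse of `C - μ`, and the difference of the two solutions for
  data in one fundamental domain `(τ, aτ)` embeds all of `L²` into the kernel
  (`exists_right_inverse_and_kernel`). An operator with a right inverse and such a kernel is
  universal (`isUniversalOperator_of_right_inverse`).
* If `a < 1`, then `C` shifts mass towards `0`, and an eigenvector would have to grow
  superexponentially (`eq_zero_of_eigenvector`). A universal operator has nonzero kernel, so no
  `C - μ` is universal. The functions `t^z exp (-ωt)` with `a^z = μ` and `ω = β / (1 - a)` give
  eigenvectors of the transpose of `C` for `0 < |μ| < κ`, so that `C - μ` is not onto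
  (`not_surjective_of_lt_one`).

In both cases the spectrum contains the punctured open disc of radius `κ`, and it is closed and
contained in the closed disc of that radius.
-/

namespace PaleyWiener

open Set Filter Topology FourierTransform

/-! ### The Fourier transform on `L¹ ∩ L²` -/

theorem continuous_fourier {g : ℝ → ℂ} (hg : Integrable g) : Continuous (𝓕 g) :=
  VectorFourier.fourierIntegral_continuous Real.continuous_fourierChar
    (by exact continuous_inner) hg

/-- On `L¹ ∩ L²` the `L²` Fourier transform is given by the Fourier integral: both functions have
the same integrals against test functions. -/
theorem fourier_toLp_ae_eq {g : ℝ → ℂ} (h1 : Integrable g) (h2 : MemLp g 2) :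
    (𝓕 (h2.toLp g) : Lp (α := ℝ) ℂ 2) =ᵐ[volume] 𝓕 g := by
  refine ae_eq_of_integral_contDiff_smul_eq
    ((Lp.memLp (𝓕 (h2.toLp g))).locallyIntegrable (by norm_num))
    (continuous_fourier h1).locallyIntegrable fun φ hφ hφc => ?_
  have hc : HasCompactSupport (fun x => (φ x : ℂ)) := hφc.comp_left (g := fun x : ℝ => (x : ℂ)) rfl
  have hd : ContDiff ℝ ((⊤ : ℕ∞) : WithTop ℕ∞) (fun x => (φ x : ℂ)) :=
    Complex.ofRealCLM.contDiff.comp hφ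
  set Φ : SchwartzMap ℝ ℂ := hc.toSchwartzMap hd with hΦ
  have h := Lp.fourier_toTemperedDistribution_eq (h2.toLp g)
  have h' := congrArg (fun T => T Φ) h
  simp only [TemperedDistribution.fourier_apply, Lp.toTemperedDistribution_apply] at h'
  have e2 : ∫ x, (𝓕 Φ) x • (h2.toLp g) x = ∫ x, (𝓕 Φ) x • g x :=
    integral_congr_ae (h2.coeFn_toLp.mono fun x hx => by simp only [hx])
  have e3 : ∫ x, (𝓕 (Φ : ℝ → ℂ)) x • g x = ∫ x, (Φ x) • (𝓕 g) x := by
    simpa only [flip_innerₗ] using! VectorFourier.integral_fourierIntegral_smul_eq_flip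
      (μ := volume) (ν := volume) (L := innerₗ ℝ) Real.continuous_fourierChar
      (by exact continuous_inner) Φ.integrable h1
  rw [e2, SchwartzMap.fourier_coe, e3] at h'
  exact h'.symm

/-- Plancherel's theorem on `L¹ ∩ L²`. -/
theorem eLpNorm_fourier {g : ℝ → ℂ} (h1 : Integrable g) (h2 : MemLp g 2) :
    eLpNorm (𝓕 g) 2 = eLpNorm g 2 := by
  rw [← eLpNorm_congr_ae (fourier_toLp_ae_eq h1 h2), ← eLpNorm_congr_ae h2.coeFn_toLp,
    ← Lp.enorm_def, ← Lp.enorm_def, ← ofReal_norm, ← ofReal_norm, Lp.norm_fourier_eq]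

/-! ### The Laplace transform on `L²(0, ∞)` -/

/-- Lebesgue measure on the half-line `(0, ∞)`. -/
noncomputable abbrev halfLine : Measure ℝ := volume.restrict (Ioi 0)

/-- The Laplace transform, normalised so that it is isometric from `L²(0, ∞)` to `H²(ℂ₊)`. -/
noncomputable def laplace (F : ℝ → ℂ) (w : ℂ) : ℂ :=
  ∫ t in Ioi (0 : ℝ), Complex.exp (-(2 * Real.pi * w) * t) * F t

theorem memLp_cpow_mul_exp {z c : ℂ} (hz : -(1 / 2) < z.re) (hc : 0 < c.re) :
    MemLp (fun t : ℝ => (t : ℂ) ^ z * Complex.exp (-c * t)) 2 halfLine := by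
  have hm : AEStronglyMeasurable (fun t : ℝ => (t : ℂ) ^ z * Complex.exp (-c * t)) halfLine := by
    refine ContinuousOn.aestronglyMeasurable (fun t ht => ?_) measurableSet_Ioi
    have : (t : ℂ) ∈ Complex.slitPlane := Or.inl (by simpa using ht)
    refine ContinuousAt.continuousWithinAt ?_
    exact (ContinuousAt.comp (f := fun t : ℝ => (t : ℂ)) (continuousAt_cpow_const this)
      (by fun_prop)).mul (by fun_prop)
  rw [memLp_two_iff_integrable_sq_norm hm]
  have h := integrableOn_rpow_mul_exp_neg_mul_rpow (p := 1) (s := 2 * z.re) (b := 2 * c.re)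
    (by linarith) one_pos (by linarith)
  refine h.congr_fun (fun t ht => ?_) measurableSet_Ioi
  have ht : 0 < t := ht
  simp only [norm_mul, Complex.norm_cpow_eq_rpow_re_of_pos ht, Complex.norm_exp, mul_pow,
    Real.rpow_one]
  rw [← Real.rpow_natCast, ← Real.rpow_mul ht.le, ← Real.exp_nat_mul]
  congr 2
  · push_cast; ring
  · simp; ring

theorem memLp_exp {c : ℂ} (hc : 0 < c.re) :
    MemLp (fun t : ℝ => Complex.exp (-c * t)) 2 halfLine := by
  simpa using memLp_cpow_mul_exp (z := 0) (by simp) hc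

theorem integrable_exp_mul {F : ℝ → ℂ} (hF : MemLp F 2 halfLine) {c : ℂ} (hc : 0 < c.re) :
    Integrable (fun t : ℝ => Complex.exp (-c * t) * F t) halfLine :=
  (memLp_exp hc).integrable_mul hF

theorem norm_exp_mul_le (F : ℝ → ℂ) {c : ℂ} (hc : 0 ≤ c.re) {t : ℝ} (ht : 0 < t) :
    ‖Complex.exp (-c * t) * F t‖ ≤ ‖F t‖ := by
  rw [norm_mul, Complex.norm_exp]
  refine mul_le_of_le_one_left (norm_nonneg _) (Real.exp_le_one_iff.2 ?_)
  simpa using mul_nonneg hc ht.le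

theorem memLp_exp_mul {F : ℝ → ℂ} (hF : MemLp F 2 halfLine) {c : ℂ} (hc : 0 ≤ c.re) :
    MemLp (fun t : ℝ => Complex.exp (-c * t) * F t) 2 halfLine := by
  refine hF.of_le (AEStronglyMeasurable.mul (by fun_prop) hF.1) ?_
  exact (ae_restrict_mem measurableSet_Ioi).mono fun t ht => norm_exp_mul_le F hc ht

theorem two_pi_mul_re (w : ℂ) : (2 * Real.pi * w).re = 2 * Real.pi * w.re := by
  simp

theorem two_pi_mul_re_pos {w : ℂ} (hw : 0 < w.re) : 0 < (2 * Real.pi * w).re := by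
  rw [two_pi_mul_re]; have := Real.pi_pos; positivity

theorem laplace_congr {F G : ℝ → ℂ} (h : F =ᵐ[halfLine] G) : laplace F = laplace G := by
  funext w
  exact integral_congr_ae (h.mono fun t ht => by simp only [ht])

theorem laplace_add {F G : ℝ → ℂ} (hF : MemLp F 2 halfLine) (hG : MemLp G 2 halfLine) {w : ℂ}
    (hw : 0 < w.re) : laplace (F + G) w = laplace F w + laplace G w := by
  simp only [laplace, Pi.add_apply, mul_add]
  exact integral_add (integrable_exp_mul hF (two_pi_mul_re_pos hw))
    (integrable_exp_mul hG (two_pi_mul_re_pos hw))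

theorem laplace_smul (c : ℂ) (F : ℝ → ℂ) (w : ℂ) : laplace (c • F) w = c * laplace F w := by
  simp only [laplace, Pi.smul_apply, smul_eq_mul, mul_left_comm _ c]
  exact integral_const_mul _ _

/-- Damping a function by an exponential translates its Laplace transform. -/
theorem laplace_exp_mul (F : ℝ → ℂ) (v w : ℂ) :
    laplace (fun t => Complex.exp (-(2 * Real.pi * v) * t) * F t) w = laplace F (w + v) := by
  simp only [laplace, ← mul_assoc, ← Complex.exp_add]
  congr 1; ext t; congr 2; ring

theorem differentiableOn_laplace {F : ℝ → ℂ} (hF : MemLp F 2 halfLine) :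
    DifferentiableOn ℂ (laplace F) rightHalfPlane := by
  intro w hw
  have hw : 0 < w.re := hw
  have hπ := Real.pi_pos
  refine DifferentiableAt.differentiableWithinAt ?_
  -- On the half-plane `Re v > Re w / 2` the derivative of the kernel is dominated by its value at
  -- `Re w / 2`.
  have hs : {v : ℂ | w.re / 2 < v.re} ∈ 𝓝 w :=
    (isOpen_lt continuous_const Complex.continuous_re).mem_nhds (by simp; linarith)
  have hb : Integrable (fun t : ℝ => ‖(t : ℂ) ^ (1 : ℂ) *
      Complex.exp (-(2 * Real.pi * (w / 2)) * t) * (2 * Real.pi * F t)‖) halfLine :=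
    ((memLp_cpow_mul_exp (z := 1) (by norm_num)
      (two_pi_mul_re_pos (by simpa using hw))).integrable_mul (hF.const_mul _)).norm
  refine (hasDerivAt_integral_of_dominated_loc_of_deriv_le (μ := halfLine)
    (F := fun (v : ℂ) (t : ℝ) => Complex.exp (-(2 * Real.pi * v) * t) * F t)
    (F' := fun (v : ℂ) (t : ℝ) =>
      Complex.exp (-(2 * Real.pi * v) * t) * (-(2 * Real.pi) * t) * F t)
    hs (Eventually.of_forall fun v => AEStronglyMeasurable.mul (by fun_prop) hF.1)
    (integrable_exp_mul hF (two_pi_mul_re_pos hw))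
    (AEStronglyMeasurable.mul (by fun_prop) hF.1) ?_ hb ?_).2.differentiableAt
  · refine (ae_restrict_mem measurableSet_Ioi).mono fun t ht v hv => ?_
    have ht : 0 < t := ht
    have hv : w.re / 2 < v.re := hv
    have h1 : ‖Complex.exp (-(2 * Real.pi * v) * t)‖ ≤
        ‖Complex.exp (-(2 * Real.pi * (w / 2)) * t)‖ := by
      rw [Complex.norm_exp, Complex.norm_exp]
      refine Real.exp_le_exp.2 ?_
      simp
      gcongr
    calc _ = ‖Complex.exp (-(2 * Real.pi * v) * t)‖ * (2 * Real.pi * t * ‖F t‖) := by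
          simp only [norm_mul, norm_neg, Complex.norm_real, Complex.norm_ofNat, Real.norm_eq_abs,
            abs_of_pos ht, abs_of_pos hπ]
          ring
      _ ≤ ‖Complex.exp (-(2 * Real.pi * (w / 2)) * t)‖ * (2 * Real.pi * t * ‖F t‖) := by
          gcongr
      _ = _ := by
          simp only [Complex.cpow_one, norm_mul, Complex.norm_real, Complex.norm_ofNat,
            Real.norm_eq_abs, abs_of_pos ht, abs_of_pos hπ]
          ring
  · refine Eventually.of_forall fun t v _ => ?_
    refine HasDerivAt.mul_const ?_ _
    refine HasDerivAt.cexp ?_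
    simpa using (((hasDerivAt_id v).const_mul (2 * Real.pi : ℂ)).neg.mul_const (t : ℂ))

/-- On a vertical line the Laplace transform of `F` is the Fourier transform of a damped copy
of `F`. -/
theorem vert_laplace (F : ℝ → ℂ) (x : ℝ) :
    HardyH2.vert (laplace F) x =
      𝓕 ((Ioi 0).indicator fun t : ℝ => Complex.exp (-(2 * Real.pi * (x : ℂ)) * t) * F t) := by
  funext y
  rw [Real.fourier_real_eq_integral_exp_smul, HardyH2.vert, laplace,
    ← integral_indicator measurableSet_Ioi]
  congr 1; ext t
  by_cases ht : t ∈ Ioi (0 : ℝ)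
  · simp only [indicator_of_mem ht, smul_eq_mul, ← mul_assoc, ← Complex.exp_add]
    congr 2; push_cast; ring
  · simp [indicator_of_notMem ht]

theorem eLpNorm_vert_laplace {F : ℝ → ℂ} (hF : MemLp F 2 halfLine) {x : ℝ} (hx : 0 < x) :
    eLpNorm (HardyH2.vert (laplace F) x) 2 =
      eLpNorm (fun t : ℝ => Complex.exp (-(2 * Real.pi * (x : ℂ)) * t) * F t) 2 halfLine := by
  have hc : 0 < (2 * Real.pi * (x : ℂ)).re := two_pi_mul_re_pos (by simpa using hx)
  rw [vert_laplace, eLpNorm_fourier, eLpNorm_indicator_eq_eLpNorm_restrict measurableSet_Ioi]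
  · exact (integrable_indicator_iff measurableSet_Ioi).2 (integrable_exp_mul hF hc)
  · exact (memLp_indicator_iff_restrict measurableSet_Ioi).2 (memLp_exp_mul hF hc.le)

/-- Removing the damping: the norm of `F` is controlled by the norms of `t ↦ exp (-2πxt) F t` as
`x → 0`, by Fatou's lemma. -/
theorem eLpNorm_le_of_forall_exp_mul {F : ℝ → ℂ} (hF : AEStronglyMeasurable F halfLine) {K : ℝ≥0∞}
    (h : ∀ x : ℝ, 0 < x → x < 1 →
      eLpNorm (fun t : ℝ => Complex.exp (-(2 * Real.pi * (x : ℂ)) * t) * F t) 2 halfLine ≤ K) :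
    eLpNorm F 2 halfLine ≤ K := by
  refine (Lp.eLpNorm_lim_le_liminf_eLpNorm (f := fun (n : ℕ) (t : ℝ) =>
    Complex.exp (-(2 * Real.pi * ((1 / ((n : ℝ) + 2) : ℝ) : ℂ)) * t) * F t)
    (fun n => AEStronglyMeasurable.mul (by fun_prop) hF) F
    (Eventually.of_forall fun t => ?_)).trans ?_
  · have h0 : Tendsto (fun n : ℕ => 1 / ((n : ℝ) + 2)) atTop (𝓝 0) :=
      tendsto_const_nhds.div_atTop
        (tendsto_atTop_add_const_right _ _ tendsto_natCast_atTop_atTop)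
    have hc : Continuous fun x : ℝ => Complex.exp (-(2 * Real.pi * (x : ℂ)) * t) * F t := by
      fun_prop
    have h1 := (hc.tendsto 0).comp h0
    simp only [Complex.ofReal_zero, mul_zero, neg_zero, zero_mul, Complex.exp_zero, one_mul] at h1
    exact h1
  · refine liminf_le_of_le (by isBoundedDefault) fun b hb => ?_
    obtain ⟨n, hn⟩ := hb.exists
    refine hn.trans (h _ (by positivity) ?_)
    rw [div_lt_one (by positivity)]
    have : (0 : ℝ) ≤ n := n.cast_nonneg
    linarith

theorem hardyENorm_laplace {F : ℝ → ℂ} (hF : MemLp F 2 halfLine) :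
    HardyH2.hardyENorm (laplace F) = eLpNorm F 2 halfLine := by
  rw [HardyH2.hardyENorm_eq]
  refine le_antisymm (iSup_le fun x => ?_) (eLpNorm_le_of_forall_exp_mul hF.1 fun x hx _ => ?_)
  · rw [eLpNorm_vert_laplace hF x.2]
    refine eLpNorm_mono_ae ((ae_restrict_mem measurableSet_Ioi).mono fun t ht => ?_)
    have hx : 0 < (((x : ℝ) : ℂ)).re := x.2
    exact norm_exp_mul_le F (c := 2 * Real.pi * ((x : ℝ) : ℂ)) (two_pi_mul_re_pos hx).le ht
  · rw [← eLpNorm_vert_laplace hF hx]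
    exact le_iSup (fun x : {x : ℝ // 0 < x} => eLpNorm (HardyH2.vert (laplace F) x) 2 volume)
      ⟨x, hx⟩

/-! ### Pointwise growth of functions in the Hardy space -/

theorem eLpNorm_vert_le (f : ℂ → ℂ) {x : ℝ} (hx : 0 < x) :
    eLpNorm (HardyH2.vert f x) 2 ≤ HardyH2.hardyENorm f := by
  rw [HardyH2.hardyENorm_eq]
  exact le_iSup (fun x : {x : ℝ // 0 < x} => eLpNorm (HardyH2.vert f x) 2 volume) ⟨x, hx⟩

theorem memLp_vert {f : ℂ → ℂ} (hf : DifferentiableOn ℂ f rightHalfPlane)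
    (hfn : HardyH2.hardyENorm f < ∞) {x : ℝ} (hx : 0 < x) : MemLp (HardyH2.vert f x) 2 :=
  ⟨(HardyH2.continuous_vert hf hx).aestronglyMeasurable, (eLpNorm_vert_le f hx).trans_lt hfn⟩

theorem lintegral_vert_sq_le (f : ℂ → ℂ) {x : ℝ} (hx : 0 < x) :
    ∫⁻ y : ℝ, ‖f ((x : ℂ) + (y : ℂ) * Complex.I)‖ₑ ^ 2 ≤ HardyH2.hardyENorm f ^ 2 := by
  rw [HardyH2.hardyENorm, ← ENNReal.rpow_natCast, ← ENNReal.rpow_mul]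
  norm_num
  exact le_iSup (fun x : {x : ℝ // 0 < x} =>
    ∫⁻ y : ℝ, ‖f (((x : ℝ) : ℂ) + (y : ℂ) * Complex.I)‖ₑ ^ 2) ⟨x, hx⟩

theorem measurable_indicator_of_continuousOn {h : ℂ → ℝ≥0∞} {s : Set ℂ} (hh : ContinuousOn h s)
    (hs : MeasurableSet s) : Measurable (s.indicator h) := by
  classical
  rw [← piecewise_eq_indicator]
  exact hh.measurable_piecewise continuousOn_const hs

/-- The mean value property on a circle, as an inequality between norms. -/
theorem enorm_le_lintegral_circle {g : ℂ → ℂ} {w : ℂ} {r : ℝ} (hr : 0 < r)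
    (hg : DifferentiableOn ℂ g (Metric.closedBall w r)) :
    ENNReal.ofReal (2 * Real.pi) * ‖g w‖ₑ ≤
      ∫⁻ θ in Ioo (-Real.pi) Real.pi, ‖g (circleMap w r θ)‖ₑ := by
  have h1 : Real.circleAverage g w r = g w :=
    DiffContOnCl.circleAverage (by
      rw [abs_of_pos hr]
      exact (hg.mono (closure_minimal Metric.ball_subset_closedBall
        Metric.isClosed_closedBall)).diffContOnCl)
  have hπ := Real.pi_pos
  have h2 : (2 * Real.pi : ℝ) • g w = ∫ θ in -Real.pi..Real.pi, g (circleMap w r θ) := by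
    rw [← h1, Real.circleAverage, smul_smul, mul_inv_cancel₀ (by positivity), one_smul]
    have hp : Function.Periodic (fun θ => g (circleMap w r θ)) (2 * Real.pi) := fun θ => by
      simp only [periodic_circleMap w r θ]
    have := hp.intervalIntegral_add_eq 0 (-Real.pi)
    rw [show (-Real.pi + 2 * Real.pi) = Real.pi by ring, zero_add] at this
    exact this
  calc ENNReal.ofReal (2 * Real.pi) * ‖g w‖ₑ = ‖(2 * Real.pi : ℝ) • g w‖ₑ := by
        rw [enorm_smul, Real.enorm_of_nonneg (by positivity)]
    _ = ‖∫ θ in Ioo (-Real.pi) Real.pi, g (circleMap w r θ)‖ₑ := by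
        rw [h2, intervalIntegral.integral_of_le (by linarith), integral_Ioc_eq_integral_Ioo]
    _ ≤ _ := enorm_integral_le_lintegral_enorm _

/-- The area version of the mean value inequality. -/
theorem enorm_le_lintegral_ball {g : ℂ → ℂ} {w : ℂ} {r : ℝ} (hr : 0 < r)
    (hg : DifferentiableOn ℂ g (Metric.closedBall w r)) :
    ENNReal.ofReal (Real.pi * r ^ 2) * ‖g w‖ₑ ≤ ∫⁻ z in Metric.ball w r, ‖g z‖ₑ := by
  have hπ := Real.pi_pos
  let h : ℂ → ℝ≥0∞ := (Metric.ball w r).indicator fun z => ‖g z‖ₑ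
  have hm : Measurable h := by
    have hc : ContinuousOn (fun z => ‖g z‖ₑ) (Metric.ball w r) :=
      (hg.continuousOn.mono Metric.ball_subset_closedBall).enorm
    exact measurable_indicator_of_continuousOn hc Metric.isOpen_ball.measurableSet
  have hsym : ∀ p : ℝ × ℝ, w + Complex.polarCoord.symm p = circleMap w p.1 p.2 := fun p => by
    rw [Complex.polarCoord_symm_apply, circleMap, Complex.exp_mul_I, ← Complex.ofReal_cos,
      ← Complex.ofReal_sin]
  have hh : ∀ ρ ∈ Ioo 0 r, ∀ θ, h (circleMap w ρ θ) = ‖g (circleMap w ρ θ)‖ₑ := fun ρ hρ θ => by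
    refine indicator_of_mem ?_ _
    have := circleMap_mem_sphere' w ρ θ
    rw [mem_sphere_iff_norm, abs_of_pos hρ.1] at this
    rw [mem_ball_iff_norm, this]
    exact hρ.2
  calc ENNReal.ofReal (Real.pi * r ^ 2) * ‖g w‖ₑ
      = (∫⁻ ρ in Ioo 0 r, ENNReal.ofReal (ρ * (2 * Real.pi))) * ‖g w‖ₑ := by
        congr 1
        rw [← ofReal_integral_eq_lintegral_ofReal]
        · rw [← integral_Ioc_eq_integral_Ioo, ← intervalIntegral.integral_of_le hr.le,
            intervalIntegral.integral_mul_const, integral_id]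
          congr 1; ring
        · refine IntegrableOn.mono_set ?_ Ioo_subset_Icc_self
          exact ContinuousOn.integrableOn_Icc (by fun_prop)
        · refine (ae_restrict_mem measurableSet_Ioo).mono fun ρ hρ => ?_
          have := hρ.1
          simp only [Pi.zero_apply]; positivity
    _ = ∫⁻ ρ in Ioo 0 r, ENNReal.ofReal ρ * (ENNReal.ofReal (2 * Real.pi) * ‖g w‖ₑ) := by
        rw [← lintegral_mul_const _ (by fun_prop)]
        refine setLIntegral_congr_fun measurableSet_Ioo fun ρ hρ => ?_
        simp only [ENNReal.ofReal_mul hρ.1.le, mul_assoc]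
    _ ≤ ∫⁻ ρ in Ioo 0 r, ENNReal.ofReal ρ *
          ∫⁻ θ in Ioo (-Real.pi) Real.pi, h (circleMap w ρ θ) := by
        refine setLIntegral_mono' measurableSet_Ioo fun ρ hρ => ?_
        gcongr
        refine (enorm_le_lintegral_circle hρ.1
          (hg.mono (Metric.closedBall_subset_closedBall hρ.2.le))).trans_eq ?_
        simp only [hh ρ hρ]
    _ ≤ ∫⁻ ρ in Ioi 0, ENNReal.ofReal ρ *
          ∫⁻ θ in Ioo (-Real.pi) Real.pi, h (circleMap w ρ θ) :=
        lintegral_mono_set Ioo_subset_Ioi_self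
    _ = ∫⁻ ρ in Ioi 0, ∫⁻ θ in Ioo (-Real.pi) Real.pi,
          ENNReal.ofReal ρ * h (circleMap w ρ θ) := by
        refine lintegral_congr fun ρ => (lintegral_const_mul _ ?_).symm
        exact hm.comp (continuous_circleMap w ρ).measurable
    _ = ∫⁻ p in polarCoord.target,
          ENNReal.ofReal p.1 • h (w + Complex.polarCoord.symm p) := by
        rw [polarCoord_target, Measure.volume_eq_prod, ← Measure.prod_restrict, lintegral_prod]
        · simp only [hsym, smul_eq_mul]
        · refine Measurable.aemeasurable ?_
          simp only [hsym, smul_eq_mul]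
          refine (by fun_prop : Measurable fun p : ℝ × ℝ => ENNReal.ofReal p.1).mul (hm.comp ?_)
          refine Continuous.measurable ?_
          simp only [circleMap]
          fun_prop
    _ = ∫⁻ z, h (w + z) := Complex.lintegral_comp_polarCoord_symm fun z => h (w + z)
    _ = ∫⁻ z, h z := lintegral_add_left_eq_self h w
    _ = _ := lintegral_indicator Metric.isOpen_ball.measurableSet _

/-- A function in the Hardy space is `O((Re w)^{-1/2})`: apply the mean value inequality to `f ^ 2`
on the disc about `w` of radius `Re w / 2`, and integrate along vertical lines. -/
theorem exists_norm_le_div_sqrt {f : ℂ → ℂ} (hf : DifferentiableOn ℂ f rightHalfPlane)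
    (hfn : HardyH2.hardyENorm f < ∞) :
    ∃ K : ℝ, 0 ≤ K ∧ ∀ w : ℂ, 0 < w.re → ‖f w‖ ≤ K / √w.re := by
  set N : ℝ := (HardyH2.hardyENorm f).toReal with hN
  have hNe : HardyH2.hardyENorm f = ENNReal.ofReal N := (ENNReal.ofReal_toReal hfn.ne).symm
  have hN0 : 0 ≤ N := ENNReal.toReal_nonneg
  refine ⟨2 * N, by positivity, fun w hw => ?_⟩
  have hπ := Real.pi_pos
  set r := w.re / 2 with hr
  have hr0 : 0 < r := by positivity
  have hsub : Metric.closedBall w r ⊆ rightHalfPlane := fun z hz => by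
    have h1 : |(z - w).re| ≤ r := (Complex.abs_re_le_norm _).trans (mem_closedBall_iff_norm.1 hz)
    have h2 := (abs_le.1 h1).1
    simp only [Complex.sub_re] at h2
    change 0 < z.re
    linarith
  have h1 := enorm_le_lintegral_ball hr0 ((hf.mono hsub).pow 2)
  have h2 : ∫⁻ z in Metric.ball w r, ‖(f ^ 2) z‖ₑ ≤ ENNReal.ofReal (2 * r * N ^ 2) := by
    let h : ℂ → ℝ≥0∞ := rightHalfPlane.indicator fun z => ‖f z‖ₑ ^ 2
    have ho : IsOpen rightHalfPlane := isOpen_lt continuous_const Complex.continuous_re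
    have hm : Measurable h := by
      have hc : ContinuousOn (fun z => ‖f z‖ₑ ^ 2) rightHalfPlane :=
        ENNReal.continuous_pow 2 |>.comp_continuousOn hf.continuousOn.enorm
      exact measurable_indicator_of_continuousOn hc ho.measurableSet
    calc ∫⁻ z in Metric.ball w r, ‖(f ^ 2) z‖ₑ = ∫⁻ z in Metric.ball w r, h z := by
          refine setLIntegral_congr_fun Metric.isOpen_ball.measurableSet fun z hz => ?_
          simp only [Pi.pow_apply, enorm_pow, h]
          exact (indicator_of_mem (hsub (Metric.ball_subset_closedBall hz))
            fun z => ‖f z‖ₑ ^ 2).symm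
      _ ≤ ∫⁻ z in {z : ℂ | z.re ∈ Ioo (w.re - r) (w.re + r)}, h z := by
          refine lintegral_mono_set fun z hz => ?_
          have h1 : |(z - w).re| < r :=
            (Complex.abs_re_le_norm _).trans_lt (mem_ball_iff_norm.1 hz)
          rw [Complex.sub_re, abs_lt] at h1
          exact ⟨by linarith [h1.1], by linarith [h1.2]⟩
      _ = ∫⁻ p in Ioo (w.re - r) (w.re + r) ×ˢ univ,
            h (Complex.measurableEquivRealProd.symm p) := by
          have hmp := Complex.volume_preserving_equiv_real_prod.symm
          rw [← hmp.setLIntegral_comp_preimage_emb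
            (Complex.measurableEquivRealProd.symm.measurableEmbedding)]
          congr 2
          ext p
          simp
      _ = ∫⁻ x in Ioo (w.re - r) (w.re + r), ∫⁻ y : ℝ,
            h (Complex.measurableEquivRealProd.symm (x, y)) := by
          rw [Measure.volume_eq_prod, ← Measure.prod_restrict, lintegral_prod, Measure.restrict_univ]
          exact (hm.comp Complex.measurableEquivRealProd.symm.measurable).aemeasurable
      _ ≤ ∫⁻ x in Ioo (w.re - r) (w.re + r), ENNReal.ofReal (N ^ 2) := by
          refine setLIntegral_mono' measurableSet_Ioo fun x hx => ?_
          have hx0 : 0 < x := by linarith [hx.1]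
          rw [ENNReal.ofReal_pow hN0, ← hNe]
          refine le_trans (lintegral_mono fun y => ?_) (lintegral_vert_sq_le f hx0)
          refine (indicator_le_self _ _ _).trans_eq ?_
          rw [Complex.measurableEquivRealProd_symm_apply, Complex.mk_eq_add_mul_I]
      _ = _ := by
          rw [lintegral_const, Measure.restrict_apply_univ, Real.volume_Ioo, mul_comm,
            ← ENNReal.ofReal_mul (by linarith)]
          congr 1; ring
  have h3 : Real.pi * r ^ 2 * ‖f w‖ ^ 2 ≤ 2 * r * N ^ 2 := by
    have := h1.trans h2
    rw [Pi.pow_apply, enorm_pow, ← ofReal_norm, ← ENNReal.ofReal_pow (norm_nonneg _),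
      ← ENNReal.ofReal_mul (by positivity)] at this
    exact (ENNReal.ofReal_le_ofReal_iff (by positivity)).1 this
  rw [le_div_iff₀ (Real.sqrt_pos.2 hw)]
  refine abs_le_of_sq_le_sq' ?_ (by positivity) |>.2
  rw [mul_pow, Real.sq_sqrt hw.le, mul_pow]
  have h4 : Real.pi * r * ‖f w‖ ^ 2 ≤ 2 * N ^ 2 := by
    refine le_of_mul_le_mul_left ?_ hr0
    linarith
  have h5 : (3 * r) * ‖f w‖ ^ 2 ≤ Real.pi * r * ‖f w‖ ^ 2 := by
    gcongr
    exact Real.pi_gt_three.le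
  have : w.re = 2 * r := by rw [hr]; ring
  rw [this]
  nlinarith [sq_nonneg N]

/-! ### Cauchy's formula on vertical lines -/

/-- The function `t ↦ exp (-2πqt)` on `(0, ∞)`, extended by zero to the line. -/
noncomputable def dampedExp (q : ℂ) : ℝ → ℂ :=
  (Ioi 0).indicator fun t : ℝ => Complex.exp (-(2 * Real.pi * q) * t)

theorem memLp_dampedExp {q : ℂ} (hq : 0 < q.re) : MemLp (dampedExp q) 2 :=
  (memLp_indicator_iff_restrict measurableSet_Ioi).2 (memLp_exp (two_pi_mul_re_pos hq))

theorem integrable_dampedExp {q : ℂ} (hq : 0 < q.re) : Integrable (dampedExp q) := by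
  refine (integrable_indicator_iff measurableSet_Ioi).2 ?_
  refine integrableOn_exp_mul_complex_Ioi ?_ 0
  have := two_pi_mul_re_pos hq
  rw [Complex.neg_re]
  linarith

theorem laplace_exp {v w : ℂ} (h : 0 < (w + v).re) :
    laplace (fun t => Complex.exp (-(2 * Real.pi * v) * t)) w = 1 / (2 * Real.pi * (w + v)) := by
  have := two_pi_mul_re_pos h
  have h1 := integral_exp_mul_complex_Ioi (a := -(2 * Real.pi * (w + v)))
    (by rw [Complex.neg_re]; linarith) 0
  simp only [Complex.ofReal_zero, mul_zero, Complex.exp_zero, neg_div_neg_eq] at h1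
  rw [laplace, ← h1]
  congr 1; ext t
  rw [← Complex.exp_add]
  congr 1; ring

theorem fourier_dampedExp {q : ℂ} (hq : 0 < q.re) (y : ℝ) :
    𝓕 (dampedExp q) y = 1 / (2 * Real.pi * (q + y * Complex.I)) := by
  have h := congrFun (vert_laplace (fun t => Complex.exp (-(2 * Real.pi * q) * t)) 0) y
  have h2 : dampedExp q = (Ioi 0).indicator fun t : ℝ =>
      Complex.exp (-(2 * Real.pi * ((0 : ℝ) : ℂ)) * t) *
        Complex.exp (-(2 * Real.pi * q) * t) := by
    simp [dampedExp]
  rw [h2, ← h, HardyH2.vert, laplace_exp (by simpa using hq)]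
  simp [add_comm]

theorem memLp_inv_sub {p : ℂ} (hp : 0 < p.re) :
    MemLp (fun y : ℝ => 1 / (p - y * Complex.I)) 2 := by
  have hq : 0 < (starRingEnd ℂ p).re := by simpa using hp
  have h := eLpNorm_fourier (integrable_dampedExp hq) (memLp_dampedExp hq)
  have h1 : MemLp (𝓕 (dampedExp (starRingEnd ℂ p))) 2 :=
    ⟨(continuous_fourier (integrable_dampedExp hq)).aestronglyMeasurable,
      h ▸ (memLp_dampedExp hq).2⟩
  refine (h1.star.const_mul (2 * Real.pi : ℂ)).ae_eq (Eventually.of_forall fun y => ?_)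
  have hπ : (Real.pi : ℂ) ≠ 0 := Complex.ofReal_ne_zero.2 Real.pi_ne_zero
  have hy : p - y * Complex.I ≠ 0 := fun h => by
    have := congrArg Complex.re h
    simp at this
    linarith
  simp only [Pi.star_apply, fourier_dampedExp hq, RCLike.star_def]
  simp only [map_div₀, map_mul, map_add, map_one, Complex.conj_conj, Complex.conj_ofReal,
    Complex.conj_I, map_ofNat]
  rw [mul_neg, ← sub_eq_add_neg]
  field_simp

/-- Parseval's identity against the Cauchy kernel. -/
theorem integral_fourier_mul_inv_sub (G : Lp ℂ 2 (volume : Measure ℝ)) {p : ℂ} (hp : 0 < p.re) :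
    ∫ y : ℝ, (𝓕 G : Lp ℂ 2 (volume : Measure ℝ)) y * (1 / (p - y * Complex.I)) =
      2 * Real.pi * laplace G p := by
  have hq : 0 < (starRingEnd ℂ p).re := by simpa using hp
  have h := Lp.inner_fourier_eq ((memLp_dampedExp hq).toLp) G
  rw [L2.inner_def, L2.inner_def] at h
  have e1 : ∫ y : ℝ, (𝓕 G : Lp ℂ 2 (volume : Measure ℝ)) y * (1 / (p - y * Complex.I)) =
      2 * Real.pi * ∫ y, inner ℂ ((𝓕 ((memLp_dampedExp hq).toLp) : Lp ℂ 2 (volume : Measure ℝ)) y)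
        ((𝓕 G : Lp ℂ 2 (volume : Measure ℝ)) y) := by
    rw [← integral_const_mul]
    refine integral_congr_ae ?_
    filter_upwards [fourier_toLp_ae_eq (integrable_dampedExp hq) (memLp_dampedExp hq)] with y hy
    have hπ : (Real.pi : ℂ) ≠ 0 := Complex.ofReal_ne_zero.2 Real.pi_ne_zero
    have hy0 : p - y * Complex.I ≠ 0 := fun h => by
      have := congrArg Complex.re h
      simp at this
      linarith
    rw [hy, fourier_dampedExp hq, RCLike.inner_apply]
    simp only [map_div₀, map_mul, map_add, map_one, Complex.conj_conj, Complex.conj_ofReal,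
      Complex.conj_I, map_ofNat]
    rw [mul_neg, ← sub_eq_add_neg]
    field_simp
  rw [e1, h, laplace, ← integral_indicator measurableSet_Ioi]
  congr 1
  refine integral_congr_ae ?_
  filter_upwards [(memLp_dampedExp hq).coeFn_toLp] with t ht
  rw [ht, RCLike.inner_apply, dampedExp]
  by_cases h0 : t ∈ Ioi (0 : ℝ)
  · rw [indicator_of_mem h0, indicator_of_mem h0, ← Complex.exp_conj, mul_comm]
    simp [map_ofNat]
  · rw [indicator_of_notMem h0, indicator_of_notMem h0]
    simp

/-- Cauchy's formula on the line `Re z = x` for a Laplace transform. -/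
theorem integral_vert_laplace_mul_inv_sub {F : ℝ → ℂ} (hF : MemLp F 2 halfLine) {x : ℝ}
    (hx : 0 < x) {p : ℂ} (hp : 0 < p.re) :
    ∫ y : ℝ, HardyH2.vert (laplace F) x y * (1 / (p - y * Complex.I)) =
      2 * Real.pi * laplace F (p + x) := by
  have hc : 0 < (2 * Real.pi * (x : ℂ)).re := two_pi_mul_re_pos (by simpa using hx)
  set g := (Ioi 0).indicator fun t : ℝ => Complex.exp (-(2 * Real.pi * (x : ℂ)) * t) * F t with hg
  have h1 : Integrable g :=
    (integrable_indicator_iff measurableSet_Ioi).2 (integrable_exp_mul hF hc)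
  have h2 : MemLp g 2 :=
    (memLp_indicator_iff_restrict measurableSet_Ioi).2 (memLp_exp_mul hF hc.le)
  have h3 := integral_fourier_mul_inv_sub h2.toLp hp
  rw [← laplace_exp_mul, vert_laplace, ← hg]
  have h4 : laplace h2.toLp p =
      laplace (fun t : ℝ => Complex.exp (-(2 * Real.pi * (x : ℂ)) * t) * F t) p := by
    refine congrFun (laplace_congr ?_) p
    filter_upwards [ae_restrict_of_ae h2.coeFn_toLp, ae_restrict_mem measurableSet_Ioi]
      with t ht ht0
    rw [ht, hg, indicator_of_mem ht0]
  rw [← h4, ← h3]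
  refine integral_congr_ae ?_
  filter_upwards [fourier_toLp_ae_eq h1 h2] with y hy
  rw [hy]

/-- Cauchy's theorem on the line `Re z = x` for a function vanishing at the point `w` to its right:
the integral over the boundary of the rectangle `[x, x + m⁶] × [-m⁸, m⁸]` vanishes, and the three
sides other than the one on the line contribute `O(1 / m)`. -/
theorem integral_vert_mul_inv_sub_of_eq_zero {f : ℂ → ℂ}
    (hf : DifferentiableOn ℂ f rightHalfPlane) (hfn : HardyH2.hardyENorm f < ∞) {x : ℝ}
    (hx : 0 < x) {p : ℂ} (hp : 0 < p.re) (h0 : f (p + x) = 0) :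
    ∫ y : ℝ, HardyH2.vert f x y * (1 / (p - y * Complex.I)) = 0 := by
  obtain ⟨K, hK0, hK⟩ := exists_norm_le_div_sqrt hf hfn
  set w : ℂ := p + x with hw
  have hwre : w.re = p.re + x := by simp [hw]
  have hwim : w.im = p.im := by simp [hw]
  have ho : IsOpen rightHalfPlane := isOpen_lt continuous_const Complex.continuous_re
  have hwm : w ∈ rightHalfPlane := by change 0 < w.re; linarith
  have hg : DifferentiableOn ℂ (dslope f w) rightHalfPlane :=
    (Complex.differentiableOn_dslope (ho.mem_nhds hwm)).2 hf
  have hgn : ∀ z : ℂ, ∀ d M : ℝ, 0 < d → d ≤ ‖z - w‖ → ‖f z‖ ≤ M → ‖dslope f w z‖ ≤ M / d := by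
    intro z d M hd hz hM
    have hne : z ≠ w := fun h => by
      rw [h, sub_self, norm_zero] at hz
      linarith
    rw [dslope_of_ne f hne, slope_def_field, h0, sub_zero, norm_div]
    exact div_le_div₀ ((norm_nonneg _).trans hM) hM hd hz
  have hvert : ∀ y : ℝ, dslope f w (x + y * Complex.I) =
      -(HardyH2.vert f x y * (1 / (p - y * Complex.I))) := by
    intro y
    have hne : (x : ℂ) + y * Complex.I ≠ w := fun h => by
      have := congrArg Complex.re h
      simp [hw] at this
      linarith
    rw [dslope_of_ne f hne, slope_def_field, h0, sub_zero, HardyH2.vert, hw,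
      mul_one_div, ← div_neg]
    congr 1; ring
  have hint : Integrable fun y : ℝ => dslope f w (x + y * Complex.I) := by
    simp only [hvert]
    exact ((memLp_vert hf hfn hx).integrable_mul (memLp_inv_sub hp)).neg
  have hlim : Tendsto (fun m : ℕ => ∫ y in (-(m : ℝ) ^ 8)..((m : ℝ) ^ 8),
      dslope f w (x + y * Complex.I)) atTop (𝓝 (∫ y : ℝ, dslope f w (x + y * Complex.I))) := by
    have h8 : Tendsto (fun m : ℕ => (m : ℝ) ^ 8) atTop atTop :=
      (tendsto_pow_atTop (by norm_num)).comp tendsto_natCast_atTop_atTop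
    exact intervalIntegral_tendsto_integral hint (tendsto_neg_atTop_atBot.comp h8) h8
  have hbound : ∀ᶠ m : ℕ in atTop, ‖∫ y in (-(m : ℝ) ^ 8)..((m : ℝ) ^ 8),
      dslope f w (x + y * Complex.I)‖ ≤ (4 * (K / √x) + 4 * K) * (1 / (m : ℝ)) := by
    filter_upwards [tendsto_natCast_atTop_atTop.eventually
      (eventually_ge_atTop (max 1 (2 * (|p.im| + p.re))) : ∀ᶠ m : ℝ in atTop, _)] with m hm
    have hm1 : (1 : ℝ) ≤ m := (le_max_left _ _).trans hm
    have hm2 : 2 * (|p.im| + p.re) ≤ m := (le_max_right _ _).trans hm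
    have hmpos : (0 : ℝ) < m := by linarith
    have hm6 : (m : ℝ) ≤ (m : ℝ) ^ 6 := le_self_pow₀ hm1 (by norm_num)
    have hm8 : (m : ℝ) ≤ (m : ℝ) ^ 8 := le_self_pow₀ hm1 (by norm_num)
    have himn : 0 ≤ |p.im| := abs_nonneg _
    have hrect := Complex.integral_boundary_rect_eq_zero_of_differentiableOn (dslope f w)
      ⟨x, -(m : ℝ) ^ 8⟩ ⟨x + (m : ℝ) ^ 6, (m : ℝ) ^ 8⟩ (hg.mono fun z hz => by
        have h1 := (Complex.mem_reProdIm.1 hz).1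
        rw [uIcc_of_le (by simp only; linarith)] at h1
        exact hx.trans_le h1.1)
    simp only at hrect
    have hhor : ∀ s : ℝ, |s| = (m : ℝ) ^ 8 →
        ‖∫ u in x..(x + (m : ℝ) ^ 6), dslope f w (u + s * Complex.I)‖ ≤ 2 * (K / √x) / m := by
      intro s hs
      have := intervalIntegral.norm_integral_le_of_norm_le_const (a := x) (b := x + (m : ℝ) ^ 6)
        (f := fun u : ℝ => dslope f w (u + s * Complex.I))
        (C := (K / √x) / ((m : ℝ) ^ 8 / 2)) (fun u hu => by
          rw [uIoc_of_le (by linarith)] at hu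
          refine hgn _ _ _ (by positivity) ?_ ?_
          · refine le_trans ?_ (Complex.abs_im_le_norm _)
            have : ((u : ℂ) + s * Complex.I - w).im = s - p.im := by simp [hwim]
            rw [this]
            have := abs_sub_abs_le_abs_sub s p.im
            rw [hs] at this
            linarith
          · have hre : ((u : ℂ) + s * Complex.I).re = u := by simp
            refine (hK _ (by rw [hre]; linarith [hu.1])).trans ?_
            rw [hre]
            gcongr
            exact hu.1.le)
      refine this.trans ?_
      rw [add_sub_cancel_left, abs_of_pos (by positivity)]
      have : (K / √x) / ((m : ℝ) ^ 8 / 2) * (m : ℝ) ^ 6 = 2 * (K / √x) / (m : ℝ) ^ 2 := by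
        field_simp
      rw [this]
      gcongr
      exact le_self_pow₀ hm1 (by norm_num)
    have hright : ‖∫ y in (-(m : ℝ) ^ 8)..((m : ℝ) ^ 8),
        dslope f w ((x + (m : ℝ) ^ 6 : ℝ) + y * Complex.I)‖ ≤ 4 * K / m := by
      have := intervalIntegral.norm_integral_le_of_norm_le_const
        (a := -(m : ℝ) ^ 8) (b := (m : ℝ) ^ 8)
        (f := fun y : ℝ => dslope f w ((x + (m : ℝ) ^ 6 : ℝ) + y * Complex.I))
        (C := (K / (m : ℝ) ^ 3) / ((m : ℝ) ^ 6 / 2)) (fun y _ => by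
          refine hgn _ _ _ (by positivity) ?_ ?_
          · refine le_trans ?_ (Complex.abs_re_le_norm _)
            have : (((x + (m : ℝ) ^ 6 : ℝ) : ℂ) + y * Complex.I - w).re = (m : ℝ) ^ 6 - p.re := by
              rw [Complex.sub_re, hwre, Complex.add_re, Complex.ofReal_re]
              simp
              ring
            rw [this]
            refine le_trans ?_ (le_abs_self _)
            linarith
          · have hre : (((x + (m : ℝ) ^ 6 : ℝ) : ℂ) + y * Complex.I).re = x + (m : ℝ) ^ 6 := by
              rw [Complex.add_re, Complex.ofReal_re]
              simp
            refine (hK _ (by rw [hre]; positivity)).trans ?_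
            rw [hre]
            gcongr
            refine Real.le_sqrt_of_sq_le ?_
            rw [← pow_mul]
            exact le_add_of_nonneg_left hx.le)
      refine this.trans_eq ?_
      rw [sub_neg_eq_add, abs_of_pos (by positivity)]
      field_simp
      ring
    have hA := hhor (-(m : ℝ) ^ 8) (by rw [abs_neg, abs_of_pos (by positivity)])
    have hB := hhor ((m : ℝ) ^ 8) (abs_of_pos (by positivity))
    have hsolve : Complex.I • ∫ y in (-(m : ℝ) ^ 8)..((m : ℝ) ^ 8),
        dslope f w (x + y * Complex.I) =
        (∫ u in x..(x + (m : ℝ) ^ 6), dslope f w (u + (-(m : ℝ) ^ 8 : ℝ) * Complex.I)) -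
        (∫ u in x..(x + (m : ℝ) ^ 6), dslope f w (u + ((m : ℝ) ^ 8 : ℝ) * Complex.I)) +
        Complex.I • ∫ y in (-(m : ℝ) ^ 8)..((m : ℝ) ^ 8),
          dslope f w ((x + (m : ℝ) ^ 6 : ℝ) + y * Complex.I) :=
      (sub_eq_zero.1 hrect).symm
    have hnorm := congrArg norm hsolve
    rw [norm_smul, Complex.norm_I, one_mul] at hnorm
    rw [hnorm]
    refine (norm_add_le _ _).trans ?_
    rw [norm_smul, Complex.norm_I, one_mul]
    refine (add_le_add (norm_sub_le _ _) le_rfl).trans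
      ((add_le_add (add_le_add hA hB) hright).trans_eq ?_)
    ring
  have hzero : Tendsto (fun m : ℕ => ∫ y in (-(m : ℝ) ^ 8)..((m : ℝ) ^ 8),
      dslope f w (x + y * Complex.I)) atTop (𝓝 0) := by
    refine squeeze_zero_norm' hbound ?_
    simpa using (tendsto_one_div_atTop_nhds_zero_nat (𝕜 := ℝ)).const_mul (4 * (K / √x) + 4 * K)
  have := tendsto_nhds_unique hlim hzero
  simp only [hvert, integral_neg, neg_eq_zero] at this
  exact this

/-- **Cauchy's formula** on a vertical line for functions in the Hardy space. -/
theorem integral_vert_mul_inv_sub {f : ℂ → ℂ}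
    (hf : DifferentiableOn ℂ f rightHalfPlane) (hfn : HardyH2.hardyENorm f < ∞) {x : ℝ}
    (hx : 0 < x) {p : ℂ} (hp : 0 < p.re) :
    ∫ y : ℝ, HardyH2.vert f x y * (1 / (p - y * Complex.I)) = 2 * Real.pi * f (p + x) := by
  have hw : 0 < (p + x).re := by simp; linarith
  -- Subtract a Laplace transform with the same value at `p + x`.
  obtain ⟨F, hF, hFw⟩ : ∃ F : ℝ → ℂ, MemLp F 2 halfLine ∧ laplace F (p + x) = f (p + x) := by
    have hq : 0 < (p + x + 1).re := by rw [Complex.add_re]; simpa using by linarith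
    have h0 : (p + x + 1) ≠ 0 := fun h => by rw [h] at hq; simp at hq
    have hπ : (Real.pi : ℂ) ≠ 0 := Complex.ofReal_ne_zero.2 Real.pi_ne_zero
    refine ⟨(f (p + x) * (2 * Real.pi * (p + x + 1))) •
      fun t : ℝ => Complex.exp (-(2 * Real.pi * (1 : ℂ)) * t),
      (memLp_exp (two_pi_mul_re_pos (by simp))).const_smul _, ?_⟩
    rw [laplace_smul, laplace_exp hq]
    field_simp
  have hLd := differentiableOn_laplace hF
  have hLn : HardyH2.hardyENorm (laplace F) < ∞ := by
    rw [hardyENorm_laplace hF]; exact hF.2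
  have hsub : f - laplace F = f + (-1 : ℂ) • laplace F := by
    rw [neg_one_smul, sub_eq_add_neg]
  have hdn : HardyH2.hardyENorm (f - laplace F) < ∞ := by
    rw [hsub]
    refine (HardyH2.hardyENorm_add_le hf (hLd.const_smul _)).trans_lt
      (ENNReal.add_lt_top.2 ⟨hfn, ?_⟩)
    rw [HardyH2.hardyENorm_smul]
    exact ENNReal.mul_lt_top enorm_lt_top hLn
  have h1 := integral_vert_mul_inv_sub_of_eq_zero (hf.sub hLd) hdn hx hp
    (by rw [Pi.sub_apply, hFw, sub_self])
  have h2 := integral_vert_laplace_mul_inv_sub hF hx hp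
  rw [← hFw, ← h2, ← sub_eq_zero, ← integral_sub]
  · rw [← h1]
    congr 1; ext y
    simp only [HardyH2.vert, Pi.sub_apply]
    ring
  · exact (memLp_vert hf hfn hx).integrable_mul (memLp_inv_sub hp)
  · exact (memLp_vert hLd hLn hx).integrable_mul (memLp_inv_sub hp)

/-! ### The Paley–Wiener theorem -/

theorem hardyENorm_congr {f g : ℂ → ℂ} (h : EqOn f g rightHalfPlane) :
    HardyH2.hardyENorm f = HardyH2.hardyENorm g := by
  simp only [HardyH2.hardyENorm_eq]
  refine iSup_congr fun x => ?_
  congr 1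
  funext y
  exact h (by simpa [rightHalfPlane] using x.2)

/-- Injectivity of the Laplace transform, a consequence of its being isometric. -/
theorem ae_eq_of_laplace_eqOn {F G : ℝ → ℂ} (hF : MemLp F 2 halfLine) (hG : MemLp G 2 halfLine)
    (h : EqOn (laplace F) (laplace G) rightHalfPlane) : F =ᵐ[halfLine] G := by
  have hsub : F - G = F + (-1 : ℂ) • G := by rw [neg_one_smul, sub_eq_add_neg]
  have h0 : EqOn (laplace (F - G)) 0 rightHalfPlane := fun w hw => by
    rw [hsub, laplace_add hF (hG.const_smul _) hw, laplace_smul, h hw]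
    simp
  have h1 : eLpNorm (F - G) 2 halfLine = 0 := by
    rw [← hardyENorm_laplace (hF.sub hG), hardyENorm_congr h0, HardyH2.hardyENorm_zero]
  rw [eLpNorm_eq_zero_iff (hF.sub hG).1 (by norm_num)] at h1
  exact h1.mono fun t ht => sub_eq_zero.1 ht

/-- On the half-plane `Re w > x`, a function in the Hardy space is the Laplace transform of the
inverse Fourier transform of its restriction to the line `Re w = x`. -/
theorem exists_laplace_of_re_pos {f : ℂ → ℂ} (hf : DifferentiableOn ℂ f rightHalfPlane)
    (hfn : HardyH2.hardyENorm f < ∞) {x : ℝ} (hx : 0 < x) :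
    ∃ F : ℝ → ℂ, MemLp F 2 halfLine ∧ eLpNorm F 2 halfLine ≤ HardyH2.hardyENorm f ∧
      ∀ p : ℂ, 0 < p.re → laplace F p = f (p + x) := by
  set fx : Lp ℂ 2 (volume : Measure ℝ) := (memLp_vert hf hfn hx).toLp with hfx
  set G : Lp ℂ 2 (volume : Measure ℝ) := 𝓕⁻ fx with hG
  have hfG : 𝓕 G = fx := FourierTransform.fourier_fourierInv_eq fx
  have hnG : eLpNorm G 2 ≤ HardyH2.hardyENorm f := by
    have h1 : ‖G‖ = ‖fx‖ := by rw [← hfG, Lp.norm_fourier_eq]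
    have h2 : ‖G‖ₑ = ‖fx‖ₑ := by rw [← ofReal_norm, ← ofReal_norm, h1]
    rw [← Lp.enorm_def, h2, Lp.enorm_def, eLpNorm_congr_ae (memLp_vert hf hfn hx).coeFn_toLp]
    exact eLpNorm_vert_le f hx
  refine ⟨G, (Lp.memLp G).restrict _, (eLpNorm_mono_measure _ Measure.restrict_le_self).trans hnG,
    fun p hp => ?_⟩
  have h1 := integral_fourier_mul_inv_sub G hp
  have h2 := integral_vert_mul_inv_sub hf hfn hx hp
  have h3 : (2 * Real.pi : ℂ) ≠ 0 := by simp [Real.pi_ne_zero]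
  refine mul_left_cancel₀ h3 ?_
  rw [← h1, ← h2, hfG]
  refine integral_congr_ae ?_
  filter_upwards [(memLp_vert hf hfn hx).coeFn_toLp] with y hy
  rw [hy]

/-- **Paley–Wiener**: every function in the Hardy space is the Laplace transform of a function in
`L²(0, ∞)`. The representing functions for the lines `Re w = x` differ by exponential factors, so
they all come from one function, whose norm is bounded by letting `x → 0`. -/
theorem exists_laplace_eq {f : ℂ → ℂ} (hf : DifferentiableOn ℂ f rightHalfPlane)
    (hfn : HardyH2.hardyENorm f < ∞) :
    ∃ F : ℝ → ℂ, MemLp F 2 halfLine ∧ EqOn (laplace F) f rightHalfPlane := by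
  obtain ⟨G, hG, -, hGf⟩ := exists_laplace_of_re_pos hf hfn one_pos
  -- Undo the damping of the representing function for the line `Re w = 1`.
  set F : ℝ → ℂ := fun t => Complex.exp ((2 * Real.pi) * t) * G t with hF
  have hFm : AEStronglyMeasurable F halfLine := AEStronglyMeasurable.mul (by fun_prop) hG.1
  have key : ∀ x : ℝ, 0 < x → x < 1 → ∃ H : ℝ → ℂ, MemLp H 2 halfLine ∧
      eLpNorm H 2 halfLine ≤ HardyH2.hardyENorm f ∧ (∀ p : ℂ, 0 < p.re → laplace H p = f (p + x)) ∧
      (fun t : ℝ => Complex.exp (-(2 * Real.pi * (x : ℂ)) * t) * F t) =ᵐ[halfLine] H := by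
    intro x hx hx1
    obtain ⟨H, hH, hHn, hHf⟩ := exists_laplace_of_re_pos hf hfn hx
    refine ⟨H, hH, hHn, hHf, ?_⟩
    have hre : 0 ≤ (2 * Real.pi * ((1 - x : ℝ) : ℂ)).re :=
      (two_pi_mul_re_pos (by rw [Complex.ofReal_re]; linarith)).le
    have h1 : G =ᵐ[halfLine] fun t : ℝ =>
        Complex.exp (-(2 * Real.pi * ((1 - x : ℝ) : ℂ)) * t) * H t := by
      refine ae_eq_of_laplace_eqOn hG (memLp_exp_mul hH hre) fun v hv => ?_
      have hv : 0 < v.re := hv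
      rw [laplace_exp_mul, hHf _ (by rw [Complex.add_re, Complex.ofReal_re]; linarith), hGf v hv]
      congr 1; push_cast; ring
    filter_upwards [h1] with t ht
    rw [hF]
    simp only [ht, ← mul_assoc, ← Complex.exp_add]
    convert one_mul _
    rw [← Complex.exp_zero]
    congr 1; push_cast; ring
  have hF2 : MemLp F 2 halfLine := by
    refine ⟨hFm, (eLpNorm_le_of_forall_exp_mul hFm fun x hx hx1 => ?_).trans_lt hfn⟩
    obtain ⟨H, -, hHn, -, hae⟩ := key x hx hx1
    rwa [eLpNorm_congr_ae hae]
  refine ⟨F, hF2, fun w hw => ?_⟩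
  have hw : 0 < w.re := hw
  have hx : 0 < min (w.re / 2) (1 / 2) := by positivity
  obtain ⟨H, -, -, hHf, hae⟩ := key _ hx ((min_le_right _ _).trans_lt (by norm_num))
  set x := min (w.re / 2) (1 / 2)
  have hp : 0 < (w - x).re := by
    have : x ≤ w.re / 2 := min_le_left _ _
    rw [Complex.sub_re, Complex.ofReal_re]; linarith
  have := hHf _ hp
  rwa [← laplace_congr hae, laplace_exp_mul, sub_add_cancel] at this

/-- The Hilbert space `L²(0, ∞)`. -/
abbrev HalfLineL2 : Type := Lp ℂ 2 halfLine

theorem indicator_laplace_mem (F : HalfLineL2) :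
    rightHalfPlane.indicator (laplace F) ∈ HardyH2.hardySubmodule := by
  have he : EqOn (rightHalfPlane.indicator (laplace F)) (laplace F) rightHalfPlane :=
    fun w hw => indicator_of_mem hw _
  refine ⟨(differentiableOn_laplace (Lp.memLp F)).congr he,
    fun w hw => indicator_of_notMem hw _, ?_⟩
  rw [hardyENorm_congr he, hardyENorm_laplace (Lp.memLp F)]
  exact (Lp.memLp F).2

/-- The Laplace transform as a linear isometry from `L²(0, ∞)` to the Hardy space. -/
noncomputable def laplaceIsometry : HalfLineL2 →ₗᵢ[ℂ] HardyH2 where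
  toFun F := (⟨rightHalfPlane.indicator (laplace F), indicator_laplace_mem F⟩ :
    HardyH2.hardySubmodule)
  map_add' F G := HardyH2.ext fun w hw => by
    change rightHalfPlane.indicator (laplace (F + G : HalfLineL2)) w =
      rightHalfPlane.indicator (laplace F) w + rightHalfPlane.indicator (laplace G) w
    simp only [indicator_of_mem hw]
    rw [laplace_congr (Lp.coeFn_add F G), laplace_add (Lp.memLp F) (Lp.memLp G) hw]
  map_smul' c F := HardyH2.ext fun w hw => by
    change rightHalfPlane.indicator (laplace (c • F : HalfLineL2)) w =
      c • rightHalfPlane.indicator (laplace F) w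
    simp only [indicator_of_mem hw]
    rw [laplace_congr (Lp.coeFn_smul c F), laplace_smul, smul_eq_mul]
  norm_map' F := by
    change (HardyH2.hardyENorm (rightHalfPlane.indicator (laplace F))).toReal = _
    rw [hardyENorm_congr (fun w hw => indicator_of_mem hw _), hardyENorm_laplace (Lp.memLp F),
      Lp.norm_def]

theorem laplaceIsometry_apply (F : HalfLineL2) {w : ℂ} (hw : w ∈ rightHalfPlane) :
    laplaceIsometry F w = laplace F w :=
  indicator_of_mem hw _

theorem laplaceIsometry_surjective : Function.Surjective laplaceIsometry := by
  intro f
  obtain ⟨F, hF, hFf⟩ := exists_laplace_eq f.differentiableOn f.hardyENorm_lt_top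
  refine ⟨hF.toLp, HardyH2.ext fun w hw => ?_⟩
  rw [laplaceIsometry_apply _ hw, laplace_congr hF.coeFn_toLp, hFf hw]

/-- The Laplace transform as an isometric isomorphism of `L²(0, ∞)` onto the Hardy space. -/
noncomputable def laplaceEquiv : HalfLineL2 ≃ₗᵢ[ℂ] HardyH2 :=
  LinearIsometryEquiv.ofSurjective laplaceIsometry laplaceIsometry_surjective

theorem laplaceEquiv_apply (F : HalfLineL2) {w : ℂ} (hw : w ∈ rightHalfPlane) :
    laplaceEquiv F w = laplace F w :=
  laplaceIsometry_apply F hw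

instance completeSpace_hardyH2 : CompleteSpace HardyH2 :=
  (completeSpace_congr (e := laplaceEquiv.toEquiv)
    laplaceEquiv.isometry.isUniformEmbedding).1 inferInstance

/-! ### Weighted composition operators on `L²(0, ∞)` -/

/-- The operator `T` on `L²(0, ∞)` is the weighted composition operator `F ↦ m · (F ∘ φ)`. The
formula is required for every representative of the class of `F`, so that such operators can be
composed by composing the formulas. -/
def IsWeightedComp (T : HalfLineL2 →L[ℂ] HalfLineL2) (m : ℝ → ℂ) (φ : ℝ → ℝ) : Prop :=
  ∀ (F : HalfLineL2) (f : ℝ → ℂ), F =ᵐ[halfLine] f → T F =ᵐ[halfLine] fun s => m s * f (φ s)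

theorem IsWeightedComp.mul {T T' : HalfLineL2 →L[ℂ] HalfLineL2} {m m' : ℝ → ℂ} {φ φ' : ℝ → ℝ}
    (h : IsWeightedComp T m φ) (h' : IsWeightedComp T' m' φ') :
    IsWeightedComp (T * T') (fun s => m s * m' (φ s)) (fun s => φ' (φ s)) := fun F f hf =>
  (h _ _ (h' F f hf)).trans (Eventually.of_forall fun _ => (mul_assoc _ _ _).symm)

theorem IsWeightedComp.one : IsWeightedComp 1 (fun _ => 1) id := fun _ _ hf =>
  hf.trans (Eventually.of_forall fun _ => (one_mul _).symm)

theorem IsWeightedComp.zero (φ : ℝ → ℝ) : IsWeightedComp 0 (fun _ => 0) φ := fun _ _ _ => by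
  filter_upwards [Lp.coeFn_zero ℂ 2 halfLine] with s hs
  simpa using hs

theorem IsWeightedComp.one_sub {T : HalfLineL2 →L[ℂ] HalfLineL2} {m : ℝ → ℂ}
    (h : IsWeightedComp T m id) : IsWeightedComp (1 - T) (fun s => 1 - m s) id := fun F f hf => by
  filter_upwards [Lp.coeFn_sub F (T F), hf, h F f hf] with s h1 h2 h3
  change (F - T F) s = _
  rw [h1, Pi.sub_apply, h2, h3, sub_mul, one_mul, id]

/-- Operators given by the same formula on `(0, ∞)` agree. The values of `φ` do not matter where the
weight vanishes. -/
theorem IsWeightedComp.eq {T T' : HalfLineL2 →L[ℂ] HalfLineL2} {m m' : ℝ → ℂ} {φ φ' : ℝ → ℝ}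
    (h : IsWeightedComp T m φ) (h' : IsWeightedComp T' m' φ')
    (he : ∀ s, 0 < s → ∀ f : ℝ → ℂ, m s * f (φ s) = m' s * f (φ' s)) : T = T' := by
  ext F
  filter_upwards [h F F (ae_eq_refl _), h' F F (ae_eq_refl _), ae_restrict_mem measurableSet_Ioi]
    with s h1 h2 hs
  rw [h1, h2, he s hs]

theorem eLpNorm_two_sq (f : ℝ → ℂ) : eLpNorm f 2 halfLine ^ 2 = ∫⁻ s in Ioi 0, ‖f s‖ₑ ^ 2 := by
  have := eLpNorm_nnreal_pow_eq_lintegral (μ := halfLine) (f := f) (p := 2) (by norm_num)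
  norm_num at this
  exact_mod_cast this

/-- Change of variables: a weighted composition operator with injective symbol `φ` on the set `S`
where the weight lives is bounded by `K` as soon as `|m|² ≤ K² |φ'|`. -/
theorem exists_isWeightedComp {m : ℝ → ℂ} {φ φ' : ℝ → ℝ} {S : Set ℝ} {K : ℝ} (hm : Measurable m)
    (hφ : Measurable φ) (hS : MeasurableSet S) (hS0 : S ⊆ Ioi 0) (hmS : ∀ s ∈ Ioi 0 \ S, m s = 0)
    (hφ' : ∀ s ∈ S, HasDerivWithinAt φ (φ' s) S s) (hinj : InjOn φ S) (hmaps : MapsTo φ S (Ioi 0))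
    (hK : 0 ≤ K) (hb : ∀ s ∈ S, ‖m s‖ ^ 2 ≤ K ^ 2 * |φ' s|) :
    ∃ T, IsWeightedComp T m φ ∧ ‖T‖ ≤ K := by
  have hle : ∀ g : ℝ → ℝ≥0∞, ∫⁻ s in Ioi 0, ‖m s‖ₑ ^ 2 * g (φ s) ≤
      ENNReal.ofReal K ^ 2 * ∫⁻ s in Ioi 0, g s := fun g =>
    calc ∫⁻ s in Ioi 0, ‖m s‖ₑ ^ 2 * g (φ s) = ∫⁻ s in S, ‖m s‖ₑ ^ 2 * g (φ s) := by
          rw [← lintegral_inter_add_sdiff _ (Ioi 0) hS, inter_eq_right.2 hS0,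
            setLIntegral_eq_zero (measurableSet_Ioi.diff hS) (fun s hs => by simp [hmS s hs]),
            add_zero]
      _ ≤ ∫⁻ s in S, ENNReal.ofReal K ^ 2 * (ENNReal.ofReal |φ' s| * g (φ s)) := by
          refine setLIntegral_mono' hS fun s hs => ?_
          rw [← mul_assoc]
          gcongr
          rw [← ofReal_norm, ← ENNReal.ofReal_pow (norm_nonneg _), ← ENNReal.ofReal_pow hK,
            ← ENNReal.ofReal_mul (by positivity)]
          exact ENNReal.ofReal_le_ofReal (hb s hs)
      _ = ENNReal.ofReal K ^ 2 * ∫⁻ s in φ '' S, g s := by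
          rw [lintegral_const_mul' _ _ (by finiteness),
            lintegral_image_eq_lintegral_abs_deriv_mul hS hφ' hinj]
      _ ≤ _ := by
          gcongr
          exact hmaps.image_subset
  have hae : ∀ f g : ℝ → ℂ, f =ᵐ[halfLine] g →
      (fun s => m s * f (φ s)) =ᵐ[halfLine] fun s => m s * g (φ s) := by
    intro f g hfg
    set N := toMeasurable halfLine {s | ¬ f s = g s} with hN
    have hN0 : halfLine N = 0 := by rw [hN, measure_toMeasurable]; exact hfg
    have hNm : MeasurableSet N := measurableSet_toMeasurable _ _
    have h1 := hle (N.indicator 1)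
    rw [lintegral_indicator_one hNm, hN0, mul_zero, nonpos_iff_eq_zero,
      lintegral_eq_zero_iff (by fun_prop (disch := assumption))] at h1
    filter_upwards [h1] with s hs
    simp only [Pi.zero_apply, mul_eq_zero, pow_eq_zero_iff two_ne_zero, enorm_eq_zero] at hs
    rcases hs with hs | hs
    · simp [hs]
    · have h2 : φ s ∉ N := fun h => by simp [indicator_of_mem h] at hs
      have h3 : f (φ s) = g (φ s) := by
        by_contra h
        exact h2 (subset_toMeasurable _ _ h)
      rw [h3]
  have hn : ∀ F : HalfLineL2, eLpNorm (fun s => m s * F (φ s)) 2 halfLine ≤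
      ENNReal.ofReal K * eLpNorm F 2 halfLine := by
    intro F
    rw [← ENNReal.pow_le_pow_left_iff two_ne_zero, mul_pow, eLpNorm_two_sq, eLpNorm_two_sq]
    refine le_trans (le_of_eq ?_) (hle fun s => ‖F s‖ₑ ^ 2)
    simp only [enorm_mul, mul_pow]
  have hmem : ∀ F : HalfLineL2, MemLp (fun s => m s * F (φ s)) 2 halfLine := fun F =>
    ⟨(hm.stronglyMeasurable.mul
      ((Lp.stronglyMeasurable F).comp_measurable hφ)).aestronglyMeasurable,
      (hn F).trans_lt (ENNReal.mul_lt_top ENNReal.ofReal_lt_top (Lp.memLp F).2)⟩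
  let T₀ : HalfLineL2 →ₗ[ℂ] HalfLineL2 :=
    { toFun := fun F => (hmem F).toLp
      map_add' := fun F G => by
        rw [← MemLp.toLp_add, MemLp.toLp_eq_toLp_iff]
        refine (hae _ _ (Lp.coeFn_add F G)).trans (Eventually.of_forall fun s => ?_)
        simp only [Pi.add_apply, mul_add]
      map_smul' := fun c F => by
        rw [RingHom.id_apply, ← MemLp.toLp_const_smul, MemLp.toLp_eq_toLp_iff]
        refine (hae _ _ (Lp.coeFn_smul c F)).trans (Eventually.of_forall fun s => ?_)
        simp only [Pi.smul_apply, smul_eq_mul]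
        ring }
  have hT₀ : ∀ F, ‖T₀ F‖ ≤ K * ‖F‖ := fun F => by
    change ‖(hmem F).toLp‖ ≤ _
    rw [Lp.norm_toLp, Lp.norm_def, ← ENNReal.toReal_ofReal hK, ← ENNReal.toReal_mul]
    exact ENNReal.toReal_mono
      (ENNReal.mul_lt_top ENNReal.ofReal_lt_top (Lp.memLp F).2).ne (hn F)
  refine ⟨T₀.mkContinuous K hT₀, fun F f hf => ?_, LinearMap.mkContinuous_norm_le _ hK _⟩
  exact (hmem F).coeFn_toLp.trans (hae _ _ hf)

/-- Multiplication operators. -/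
theorem exists_isWeightedComp_id {m : ℝ → ℂ} {K : ℝ} (hm : Measurable m) (hK : 0 ≤ K)
    (hb : ∀ s, 0 < s → ‖m s‖ ≤ K) : ∃ T, IsWeightedComp T m id ∧ ‖T‖ ≤ K := by
  refine exists_isWeightedComp (S := Ioi 0) (φ' := fun _ => 1) hm measurable_id measurableSet_Ioi
    le_rfl (by simp) (fun s _ => hasDerivWithinAt_id s _) (injOn_id _) (mapsTo_id _) hK
    fun s hs => ?_
  rw [abs_one, mul_one]
  exact pow_le_pow_left₀ (norm_nonneg _) (hb s hs) 2

/-- Dilations, with a weight. -/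
theorem exists_isWeightedComp_mul {m : ℝ → ℂ} {K c : ℝ} (hm : Measurable m) (hc : 0 < c)
    (hK : 0 ≤ K) (hb : ∀ s, 0 < s → ‖m s‖ ^ 2 ≤ K ^ 2 * c) :
    ∃ T, IsWeightedComp T m (fun s => c * s) ∧ ‖T‖ ≤ K := by
  refine exists_isWeightedComp (S := Ioi 0) (φ' := fun _ => c) hm (by fun_prop) measurableSet_Ioi
    le_rfl (by simp) (fun s _ => ?_) (fun s _ t _ h => mul_left_cancel₀ hc.ne' h)
    (fun s hs => mul_pos hc hs) hK fun s hs => ?_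
  · simpa using ((hasDerivAt_id s).const_mul c).hasDerivWithinAt
  · rw [abs_of_pos hc]
    exact hb s hs

theorem IsWeightedComp.norm_le_of_id {T : HalfLineL2 →L[ℂ] HalfLineL2} {m : ℝ → ℂ} {K : ℝ}
    (h : IsWeightedComp T m id) (hm : Measurable m) (hK : 0 ≤ K) (hb : ∀ s, 0 < s → ‖m s‖ ≤ K) :
    ‖T‖ ≤ K := by
  obtain ⟨T', hT', hn⟩ := exists_isWeightedComp_id hm hK hb
  rwa [h.eq hT' fun _ _ _ => rfl]

theorem IsWeightedComp.norm_le_of_mul {T : HalfLineL2 →L[ℂ] HalfLineL2} {m : ℝ → ℂ} {K c : ℝ}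
    (h : IsWeightedComp T m (fun s => c * s)) (hm : Measurable m) (hc : 0 < c) (hK : 0 ≤ K)
    (hb : ∀ s, 0 < s → ‖m s‖ ^ 2 ≤ K ^ 2 * c) : ‖T‖ ≤ K := by
  obtain ⟨T', hT', hn⟩ := exists_isWeightedComp_mul hm hc hK hb
  rwa [h.eq hT' fun _ _ _ => rfl]

/-- There is an isometry of `L²(0, ∞)` into the functions supported in `(τ, σ)`, induced by the
Möbius transformation that maps `(τ, σ)` onto `(0, ∞)`; it has a left inverse. -/
theorem exists_compression {τ σ : ℝ} (hτ : 0 < τ) (hσ : τ < σ) :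
    ∃ (A B : HalfLineL2 →L[ℂ] HalfLineL2) (m : ℝ → ℂ) (φ : ℝ → ℝ), IsWeightedComp A m φ ∧
      (∀ s, s ∉ Ioo τ σ → m s = 0) ∧ B * A = 1 := by
  set d := σ - τ with hd
  have hd0 : 0 < d := sub_pos.2 hσ
  obtain ⟨A, hA, -⟩ := exists_isWeightedComp (K := 1) (S := Ioo τ σ)
    (m := (Ioo τ σ).indicator fun s => ((√d / (σ - s) : ℝ) : ℂ))
    (φ := fun s => (s - τ) / (σ - s)) (φ' := fun s => d / (σ - s) ^ 2)
    (Measurable.indicator (by fun_prop) measurableSet_Ioo) (by fun_prop) measurableSet_Ioo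
    (fun s hs => hτ.trans hs.1) (fun s hs => indicator_of_notMem hs.2 _)
    (fun s hs => by
      have h0 : σ - s ≠ 0 := (sub_pos.2 hs.2).ne'
      refine HasDerivAt.hasDerivWithinAt ?_
      refine (((hasDerivAt_id' s).sub_const τ).div
        ((hasDerivAt_id' s).const_sub σ) h0).congr_deriv ?_
      rw [hd]
      ring)
    (fun s hs t ht h => by
      have h1 : σ - s ≠ 0 := (sub_pos.2 hs.2).ne'
      have h2 : σ - t ≠ 0 := (sub_pos.2 ht.2).ne'
      simp only [div_eq_div_iff h1 h2] at h
      have : d * (s - t) = 0 := by rw [hd]; linear_combination h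
      exact sub_eq_zero.1 ((mul_eq_zero.1 this).resolve_left hd0.ne'))
    (fun s hs => div_pos (sub_pos.2 hs.1) (sub_pos.2 hs.2)) zero_le_one
    (fun s hs => by
      have h1 : 0 < σ - s := sub_pos.2 hs.2
      rw [indicator_of_mem hs, Complex.norm_real, Real.norm_eq_abs, sq_abs, div_pow,
        Real.sq_sqrt hd0.le, one_pow, one_mul]
      exact le_abs_self _)
  obtain ⟨B, hB, -⟩ := exists_isWeightedComp (K := 1) (S := Ioi 0)
    (m := fun u => ((√d / (1 + u) : ℝ) : ℂ))
    (φ := fun u => (τ + u * σ) / (1 + u)) (φ' := fun u => d / (1 + u) ^ 2)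
    (by fun_prop) (by fun_prop) measurableSet_Ioi
    le_rfl (fun s hs => (hs.2 hs.1).elim)
    (fun u hu => by
      have hu : 0 < u := hu
      have h0 : 1 + u ≠ 0 := by positivity
      refine HasDerivAt.hasDerivWithinAt ?_
      refine ((((hasDerivAt_id' u).mul_const σ).const_add τ).div
        ((hasDerivAt_id' u).const_add 1) h0).congr_deriv ?_
      rw [hd]
      ring)
    (fun s hs t ht h => by
      have hs : 0 < s := hs
      have ht : 0 < t := ht
      have h1 : 1 + s ≠ 0 := by positivity
      have h2 : 1 + t ≠ 0 := by positivity
      simp only [div_eq_div_iff h1 h2] at h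
      have : d * (s - t) = 0 := by rw [hd]; linear_combination h
      exact sub_eq_zero.1 ((mul_eq_zero.1 this).resolve_left hd0.ne'))
    (fun u hu => by
      have hu : 0 < u := hu
      have hσ0 : 0 < σ := hτ.trans hσ
      have h1 : 0 < (τ + u * σ) / (1 + u) := by positivity
      exact h1) zero_le_one
    (fun u hu => by
      rw [Complex.norm_real, Real.norm_eq_abs, sq_abs, div_pow, Real.sq_sqrt hd0.le, one_pow,
        one_mul]
      exact le_abs_self _)
  refine ⟨A, B, _, _, hA, fun s hs => indicator_of_notMem hs _, ?_⟩
  refine (hB.mul hA).eq IsWeightedComp.one fun u hu f => ?_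
  have h0 : 0 < 1 + u := by positivity
  have h1 : σ - (τ + u * σ) / (1 + u) = d / (1 + u) := by rw [hd]; field_simp; ring
  have h2 : (τ + u * σ) / (1 + u) - τ = u * d / (1 + u) := by rw [hd]; field_simp; ring
  have hmem : (τ + u * σ) / (1 + u) ∈ Ioo τ σ := by
    constructor
    · rw [← sub_pos, h2]; positivity
    · rw [← sub_pos, h1]; positivity
  rw [indicator_of_mem hmem, h1, h2, ← Complex.ofReal_mul]
  have h3 : √d / (1 + u) * (√d / (d / (1 + u))) = 1 := by
    have := Real.mul_self_sqrt hd0.le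
    field_simp
    nlinarith
  have h4 : u * d / (1 + u) / (d / (1 + u)) = u := by field_simp
  rw [h3, h4]
  simp

/-! ### A criterion for universality -/

/-- The copy of `α T` inside `U` is carried by the range of a left-invertible intertwiner `J`. -/
theorem isUniversalOperator_of_intertwiner {E : Type*} [NormedAddCommGroup E] [NormedSpace ℂ E]
    {U : E →L[ℂ] E} (h : ∀ T : E →L[ℂ] E, ∃ α : ℂ, α ≠ 0 ∧ ∃ J W : E →L[ℂ] E,
      W * J = 1 ∧ U * J = α • (J * T)) : IsUniversalOperator U := by
  intro T
  obtain ⟨α, hα, J, W, hWJ, hUJ⟩ := h T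
  have hW : ∀ x, W (J x) = x := fun x => congrArg (fun A : E →L[ℂ] E => A x) hWJ
  have hU : ∀ x, U (J x) = J (α • T x) := fun x => by
    rw [map_smul]; exact congrArg (fun A : E →L[ℂ] E => A x) hUJ
  -- The range of `J` is the kernel of `1 - J W`, hence closed.
  set M : Submodule ℂ E := (1 - J * W : E →L[ℂ] E).ker with hM
  have hmem : ∀ y, y ∈ M ↔ y = J (W y) := fun y => by
    rw [hM, LinearMap.mem_ker]
    exact sub_eq_zero
  have hJM : ∀ x, J x ∈ M := fun x => (hmem _).2 (by rw [hW])
  refine ⟨α, hα, M, ContinuousLinearMap.isClosed_ker _, fun x hx => ?_,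
    ContinuousLinearEquiv.equivOfInverse (J.codRestrict M hJM) (W ∘L M.subtypeL) hW
      (fun y => Subtype.ext ((hmem y).1 y.2).symm), fun x => ?_⟩
  · rw [(hmem x).1 hx, hU]
    exact hJM _
  · exact hU x

/-- For small `α` the map `J ↦ α R J T` is a contraction, so the equation is solvable. -/
theorem exists_eq_add_smul_mul_mul {𝔄 : Type*} [NormedRing 𝔄] [NormedAlgebra ℂ 𝔄]
    [CompleteSpace 𝔄] (R T V : 𝔄) : ∃ α : ℂ, α ≠ 0 ∧ ∃ J : 𝔄, J = V + α • (R * J * T) := by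
  set α : ℂ := (((‖R‖ * ‖T‖ + 1)⁻¹ : ℝ) : ℂ) with hα
  have hpos : 0 < ‖R‖ * ‖T‖ + 1 := by positivity
  set Λ : 𝔄 →L[ℂ] 𝔄 := α • ContinuousLinearMap.mulLeftRight ℂ 𝔄 R T with hΛ
  have hΛn : ‖Λ‖ < 1 := by
    rw [hΛ, norm_smul]
    have h1 := ContinuousLinearMap.opNorm_mulLeftRight_apply_apply_le ℂ 𝔄 R T
    have h2 : ‖α‖ = (‖R‖ * ‖T‖ + 1)⁻¹ := by
      rw [hα, Complex.norm_real, Real.norm_of_nonneg (inv_pos.2 hpos).le]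
    rw [h2, inv_mul_lt_one₀ hpos]
    linarith
  obtain ⟨S, hS⟩ := (isUnit_one_sub_of_norm_lt_one hΛn).exists_right_inv
  refine ⟨α, Complex.ofReal_ne_zero.2 (inv_pos.2 hpos).ne', S V, ?_⟩
  have h1 : S V - Λ (S V) = V := congrArg (fun A : 𝔄 →L[ℂ] 𝔄 => A V) hS
  have h2 : Λ (S V) = α • (R * S V * T) := rfl
  rw [← h2]
  exact sub_eq_iff_eq_add.1 h1

/-- A Caradus-type criterion: `U` is universal if it has a right inverse `R` and its kernel contains
the range of a left-invertible operator `V`. For given `T` and small `α` the solution of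
`J = V + α R J T` intertwines `U` with `α T`, and `(1 - R U) J = V`. -/
theorem isUniversalOperator_of_right_inverse {E : Type*} [NormedAddCommGroup E] [NormedSpace ℂ E]
    [CompleteSpace E] {U R V W : E →L[ℂ] E} (hR : U * R = 1) (hV : U * V = 0) (hW : W * V = 1) :
    IsUniversalOperator U := by
  refine isUniversalOperator_of_intertwiner fun T => ?_
  obtain ⟨α, hα0, J, hfix⟩ := exists_eq_add_smul_mul_mul R T V
  have hUJ : U * J = α • (J * T) := by
    calc U * J = U * V + α • (U * R * J * T) := by
          conv_lhs => rw [hfix]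
          rw [mul_add, mul_smul_comm]
          simp only [mul_assoc]
      _ = α • (J * T) := by rw [hV, hR, zero_add, one_mul]
  refine ⟨α, hα0, J, W * (1 - R * U), ?_, hUJ⟩
  have h3 : (1 - R * U) * J = V := by
    rw [sub_mul, one_mul, mul_assoc, hUJ, mul_smul_comm, ← mul_assoc]
    nth_rewrite 1 [hfix]
    abel
  rw [mul_assoc, h3, hW]

/-- The operators required by the universality criterion, for a perturbation of a dilation `D`. In
the application `χ ≤ χ'` are the multiplications by the indicators of `(0, τ)` and `(0, aτ)`. On
functions supported near `0` the equation `(C - μ) F = H` is solved by conjugating `C` to `D` by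
`M`, and away from `0` by inverting `C (1 - χ) - μ`, a perturbation of `-μ`. On functions
supported in `(τ, aτ)`, the range of `A`, both methods apply; the first gives solutions vanishing on
`(τ, aτ)`, the second solutions equal to `-μ⁻¹ H` there, so their difference embeds the range of `A`
in the kernel of `C - μ`. -/
theorem exists_right_inverse_and_kernel {𝔄 : Type*} [NormedRing 𝔄] [NormedAlgebra ℂ 𝔄]
    [CompleteSpace 𝔄] {C D D' χ χ' M M' A B : 𝔄} {μ : ℂ} (hμ : μ ≠ 0) (hDD' : D * D' = 1)
    (hCM : C * M = M * D) (hMM' : M * M' = χ') (hχ'M' : χ' * M' = M') (hMχ : χ * M = M * χ)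
    (hχχ : χ * χ = χ) (hχχ' : χ * χ' = χ) (hχ'χ : χ' * χ = χ)
    (hshift : D' * χ' = χ * D') (hC0 : χ' * (C * (1 - χ)) = 0) (hn1 : ‖μ • D'‖ < 1)
    (hn2 : ‖C * (1 - χ)‖ < ‖μ‖) (hn3 : ‖1 - χ'‖ ≤ 1) (hA : χ * A = 0) (hA' : χ' * A = A)
    (hBA : B * A = 1) :
    ∃ R V W : 𝔄, (C - μ • 1) * R = 1 ∧ (C - μ • 1) * V = 0 ∧ W * V = 1 := by
  have hμ0 : 0 < ‖μ‖ := norm_pos_iff.2 hμ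
  -- `X` is a right inverse of `D - μ`.
  obtain ⟨Y, hY⟩ := (isUnit_one_sub_of_norm_lt_one hn1).exists_right_inv
  set X := D' * Y with hX
  have hY' : Y = 1 + μ • X := by
    rw [sub_mul, one_mul, smul_mul_assoc, ← hX] at hY
    rw [← hY]; abel
  have hDX : D * X = 1 + μ • X := by rw [hX, ← mul_assoc, hDD', one_mul, ← hX, ← hY']
  have hX' : X = D' + μ • (D' * X) := by
    conv_lhs => rw [hX, hY']
    rw [mul_add, mul_one, mul_smul_comm]
  -- `X` maps functions supported in `(0, aτ)` to functions supported in `(0, τ)`.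
  have hZ : (1 - χ) * X * χ' = 0 := by
    set Z := (1 - χ) * X * χ' with hZ
    have h1 : (1 - χ') * (1 - χ) = 1 - χ' := by
      rw [mul_sub, mul_one, sub_mul, one_mul, hχ'χ, sub_self, sub_zero]
    have h2 : (1 - χ) * D' = D' * (1 - χ') := by
      rw [sub_mul, one_mul, mul_sub, mul_one, hshift]
    have h3 : (1 - χ) * D' * χ' = 0 := by
      rw [mul_assoc, hshift, ← mul_assoc, sub_mul, one_mul, hχχ, sub_self, zero_mul]
    have h4 : Z = (μ • D') * ((1 - χ') * Z) := by
      calc Z = (1 - χ) * (D' + μ • (D' * X)) * χ' := by rw [← hX']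
        _ = (1 - χ) * D' * χ' + μ • ((1 - χ) * D' * X * χ') := by
            rw [mul_add, add_mul, mul_smul_comm, smul_mul_assoc]
            simp only [mul_assoc]
        _ = μ • (D' * ((1 - χ') * (1 - χ)) * X * χ') := by rw [h3, zero_add, h2, h1]
        _ = _ := by rw [smul_mul_assoc, hZ]; simp only [mul_assoc]
    have h5 : ‖Z‖ ≤ ‖μ • D'‖ * ‖Z‖ := by
      conv_lhs => rw [h4]
      refine (norm_mul_le _ _).trans ?_
      gcongr
      refine (norm_mul_le _ _).trans ?_
      exact mul_le_of_le_one_left (norm_nonneg _) hn3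
    have h6 : ‖Z‖ = 0 := by
      by_contra h
      have : 0 < ‖Z‖ := lt_of_le_of_ne (norm_nonneg _) (Ne.symm h)
      nlinarith
    exact norm_eq_zero.1 h6
  -- `S` solves the equation for right-hand sides supported in `(0, aτ)`.
  set S := M * X * M' with hS
  have hCS : (C - μ • 1) * S = χ' := by
    calc (C - μ • 1) * S = C * M * X * M' - μ • (M * X * M') := by
          rw [hS, sub_mul, smul_mul_assoc, one_mul]; simp only [mul_assoc]
      _ = M * (D * X) * M' - μ • (M * X * M') := by rw [hCM]; simp only [mul_assoc]
      _ = M * M' := by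
          rw [hDX, mul_add, add_mul, mul_one, mul_smul_comm, smul_mul_assoc, add_sub_cancel_right]
      _ = χ' := hMM'
  -- `N` is the inverse of `C (1 - χ) - μ`.
  obtain ⟨N, hN⟩ : ∃ N, (C * (1 - χ) - μ • 1) * N = 1 := by
    have h1 : ‖μ⁻¹ • (C * (1 - χ))‖ < 1 := by
      refine (norm_smul_le _ _).trans_lt ?_
      rw [norm_inv, inv_mul_lt_one₀ hμ0]
      exact hn2
    obtain ⟨N, hN⟩ := (isUnit_one_sub_of_norm_lt_one h1).exists_right_inv
    refine ⟨-(μ⁻¹ • N), ?_⟩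
    have h2 : C * (1 - χ) - μ • 1 = -(μ • (1 - μ⁻¹ • (C * (1 - χ)))) := by
      rw [smul_sub, smul_smul, mul_inv_cancel₀ hμ, one_smul, neg_sub]
    rw [h2, neg_mul_neg, smul_mul_smul_comm, hN, mul_inv_cancel₀ hμ, one_smul]
  have hCN : (C - μ • 1) * ((1 - χ) * N) = 1 + μ • (χ * N) := by
    calc (C - μ • 1) * ((1 - χ) * N) = (C * (1 - χ) - μ • 1) * N + μ • (χ * N) := by
          simp only [sub_mul, mul_sub, one_mul, mul_one, smul_mul_assoc, mul_assoc]
          abel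
      _ = _ := by rw [hN]
  have hχ'N : χ' = -(μ • (χ' * N)) := by
    calc χ' = χ' * ((C * (1 - χ) - μ • 1) * N) := by rw [hN, mul_one]
      _ = χ' * (C * (1 - χ)) * N - μ • (χ' * N) := by
          rw [sub_mul, mul_sub, smul_mul_assoc, one_mul, mul_smul_comm]; simp only [mul_assoc]
      _ = _ := by rw [hC0, zero_mul, zero_sub]
  have hχN : χ = -(μ • (χ * N)) := by
    conv_lhs => rw [← hχχ', hχ'N]
    rw [mul_neg, mul_smul_comm, ← mul_assoc, hχχ']
  have hχNA : μ • (χ * N * A) = 0 := by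
    have : -(μ • (χ * N)) * A = 0 := by rw [← hχN, hA]
    rwa [neg_mul, smul_mul_assoc, neg_eq_zero] at this
  have hχ'NA : μ • (χ' * N * A) = -A := by
    have : -(μ • (χ' * N)) * A = A := by rw [← hχ'N, hA']
    rw [neg_mul, smul_mul_assoc] at this
    exact neg_eq_iff_eq_neg.1 this
  refine ⟨(1 - χ) * N - μ • (S * (χ * N)), (S - (1 - χ) * N) * A, μ • (B * (χ' * (1 - χ))),
    ?_, ?_, ?_⟩
  · rw [mul_sub, hCN, mul_smul_comm, ← mul_assoc _ S, hCS, ← mul_assoc χ', hχ'χ,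
      add_sub_cancel_right]
  · rw [← mul_assoc, mul_sub, hCS, hCN, sub_mul, add_mul, hA', one_mul, smul_mul_assoc, hχNA,
      add_zero, sub_self]
  · have h1 : χ' * (1 - χ) * S = 0 := by
      calc χ' * (1 - χ) * S = χ' * ((1 - χ) * M) * X * (χ' * M') := by
            rw [hS, hχ'M']; simp only [mul_assoc]
        _ = χ' * M * ((1 - χ) * X * χ') * M' := by
            rw [sub_mul, one_mul, hMχ]
            simp only [mul_assoc, mul_sub, sub_mul, one_mul]
        _ = 0 := by rw [hZ, mul_zero, zero_mul]
    have h2 : χ' * (1 - χ) * ((1 - χ) * N) = χ' * N - χ * N := by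
      rw [← mul_assoc, mul_sub χ', mul_one, hχ'χ, mul_sub, mul_one, sub_mul _ _ χ, hχ'χ, hχχ,
        sub_self, sub_zero, sub_mul]
    calc μ • (B * (χ' * (1 - χ))) * ((S - (1 - χ) * N) * A)
        = μ • (B * ((χ' * (1 - χ) * S - χ' * (1 - χ) * ((1 - χ) * N)) * A)) := by
          rw [smul_mul_assoc]
          simp only [mul_assoc, mul_sub, sub_mul]
      _ = B * (μ • (χ * N * A) - μ • (χ' * N * A)) := by
          rw [h1, h2, zero_sub, neg_sub, sub_mul, ← smul_sub, mul_smul_comm]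
      _ = 1 := by rw [hχNA, hχ'NA, zero_sub, neg_neg, hBA]

/-! ### The composition operator on the side of `L²(0, ∞)` -/

/-- The weight of the operator on `L²(0, ∞)` that corresponds to `f ↦ f (a w + b)`, where
`β = 2πb`. -/
noncomputable def dilationWeight (a : ℝ) (β : ℂ) (s : ℝ) : ℂ :=
  ((a⁻¹ : ℝ) : ℂ) * Complex.exp (-β * ((a⁻¹ * s : ℝ) : ℂ))

theorem measurable_dilationWeight (a : ℝ) (β : ℂ) : Measurable (dilationWeight a β) := by
  unfold dilationWeight
  fun_prop

theorem norm_dilationWeight {a : ℝ} (ha : 0 < a) (β : ℂ) (s : ℝ) :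
    ‖dilationWeight a β s‖ = a⁻¹ * Real.exp (-β.re * (a⁻¹ * s)) := by
  rw [dilationWeight, norm_mul, Complex.norm_real, Real.norm_of_nonneg (inv_pos.2 ha).le,
    Complex.norm_exp, Complex.re_mul_ofReal, Complex.neg_re]

theorem rpow_neg_half_sq {a : ℝ} (ha : 0 < a) : (a ^ (-(1 / 2) : ℝ)) ^ 2 = a⁻¹ := by
  rw [← Real.rpow_natCast, ← Real.rpow_mul ha.le, ← Real.rpow_neg_one]
  norm_num

theorem exists_isWeightedComp_dilation {a : ℝ} (ha : 0 < a) {β : ℂ} (hβ : 0 ≤ β.re) :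
    ∃ T, IsWeightedComp T (dilationWeight a β) (fun s => a⁻¹ * s) ∧
      ‖T‖ ≤ a ^ (-(1 / 2) : ℝ) := by
  refine exists_isWeightedComp_mul (measurable_dilationWeight a β) (inv_pos.2 ha)
    (Real.rpow_nonneg ha.le _) fun s hs => ?_
  rw [norm_dilationWeight ha, rpow_neg_half_sq ha, ← sq]
  refine pow_le_pow_left₀ (by positivity) (mul_le_of_le_one_right (by positivity) ?_) 2
  rw [Real.exp_le_one_iff, neg_mul, neg_nonpos]
  positivity

/-- The Laplace transform conjugates the composition operator to a weighted dilation. -/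
theorem exists_laplaceEquiv_compOp (a : ℝ) (b : ℂ) (ha : 0 < a) (hb : 0 ≤ b.re) :
    ∃ T, IsWeightedComp T (dilationWeight a (2 * Real.pi * b)) (fun s => a⁻¹ * s) ∧
      ∀ F, laplaceEquiv (T F) = HardyH2.compOp a b ha hb (laplaceEquiv F) := by
  obtain ⟨T, hT, -⟩ := exists_isWeightedComp_dilation ha (β := 2 * Real.pi * b)
    (by rw [two_pi_mul_re]; have := Real.pi_pos; positivity)
  refine ⟨T, hT, fun F => HardyH2.ext fun w hw => ?_⟩
  have hw' : (a : ℂ) * w + b ∈ rightHalfPlane := HardyH2.mapsTo_affineSymbol ha hb hw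
  have ha0 : (a : ℂ) ≠ 0 := Complex.ofReal_ne_zero.2 ha.ne'
  rw [HardyH2.compOp_apply ha hb _ hw, laplaceEquiv_apply _ hw, laplaceEquiv_apply _ hw',
    laplace_congr (hT F F (ae_eq_refl _)), laplace, laplace]
  have h := integral_comp_mul_left_Ioi
    (fun t : ℝ => Complex.exp (-(2 * Real.pi * ((a : ℂ) * w + b)) * t) * F t) 0 (inv_pos.2 ha)
  rw [mul_zero, inv_inv, Complex.real_smul] at h
  rw [← mul_right_inj' ha0, ← h, ← integral_const_mul]
  congr 1; ext s
  simp only [dilationWeight]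
  push_cast
  have e : Complex.exp (-(2 * Real.pi * (a * w + b)) * ((a : ℂ)⁻¹ * s)) =
      Complex.exp (-(2 * Real.pi * w) * s) * Complex.exp (-(2 * Real.pi * b) * ((a : ℂ)⁻¹ * s)) := by
    rw [← Complex.exp_add]
    congr 1
    field_simp
    ring
  rw [e]
  field_simp

/-- Away from `0` the operator is small. -/
theorem norm_mul_le_of_isWeightedComp {a : ℝ} (ha : 0 < a) {β : ℂ} (hβ : 0 < β.re) {τ : ℝ}
    {C Q : HalfLineL2 →L[ℂ] HalfLineL2}
    (hC : IsWeightedComp C (dilationWeight a β) (fun s => a⁻¹ * s))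
    (hQ : IsWeightedComp Q ((Ici τ).indicator 1) id) :
    ‖C * Q‖ ≤ a ^ (-(1 / 2) : ℝ) * Real.exp (-β.re * τ) := by
  refine (hC.mul hQ).norm_le_of_mul ?_ (inv_pos.2 ha) (by positivity) fun s hs => ?_
  · exact (measurable_dilationWeight a β).mul
      ((measurable_const.indicator measurableSet_Ici).comp (by fun_prop))
  · by_cases h : a⁻¹ * s ∈ Ici τ
    · have h' : τ ≤ a⁻¹ * s := h
      rw [indicator_of_mem h, Pi.one_apply, mul_one, norm_dilationWeight ha, mul_pow, mul_pow,
        rpow_neg_half_sq ha]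
      have hE : Real.exp (-β.re * (a⁻¹ * s)) ≤ Real.exp (-β.re * τ) :=
        Real.exp_le_exp.2 (by nlinarith)
      have := mul_le_mul_of_nonneg_left (pow_le_pow_left₀ (Real.exp_pos _).le hE 2) (sq_nonneg a⁻¹)
      linarith
    · rw [indicator_of_notMem h, mul_zero, norm_zero, zero_pow two_ne_zero]
      positivity

theorem exists_exp_lt (κ : ℝ) {r ε : ℝ} (hr : 0 < r) (hε : 0 < ε) :
    ∃ τ₀ : ℝ, ∀ τ, τ₀ ≤ τ → κ * Real.exp (-r * τ) < ε := by
  have h1 : Tendsto (fun τ : ℝ => κ * Real.exp (-r * τ)) atTop (𝓝 (κ * 0)) := by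
    refine (Real.tendsto_exp_atBot.comp ?_).const_mul κ
    exact tendsto_id.const_mul_atTop_of_neg (neg_neg_of_pos hr)
  rw [mul_zero] at h1
  exact eventually_atTop.1 (h1.eventually_lt_const hε)

/-- Multiplication by the indicator of `(-∞, τ)`, and the complementary projection. -/
theorem exists_isWeightedComp_indicator_Iio {τ : ℝ} :
    ∃ χ, IsWeightedComp χ ((Iio τ).indicator 1) id ∧
      IsWeightedComp (1 - χ) ((Ici τ).indicator 1) id := by
  obtain ⟨χ, hχ, -⟩ := exists_isWeightedComp_id (m := (Iio τ).indicator 1) (K := 1)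
    (measurable_const.indicator measurableSet_Iio) zero_le_one (fun s _ => by
      by_cases h : s ∈ Iio τ
      · simp [indicator_of_mem h]
      · simp [indicator_of_notMem h])
  refine ⟨χ, hχ, ?_⟩
  convert hχ.one_sub using 1
  ext s
  by_cases h : s < τ
  · rw [indicator_of_mem (mem_Iio.2 h), indicator_of_notMem (by simpa using h)]
    simp
  · rw [indicator_of_mem (mem_Ici.2 (not_lt.1 h)), indicator_of_notMem (by simpa using h)]
    simp

/-- For `a > 1` the equation `C F - μ F = H` is solvable, with a large space of solutions of the
homogeneous equation. -/
theorem exists_right_inverse_and_kernel_of_one_lt {a : ℝ} (ha1 : 1 < a) {β : ℂ} (hβ : 0 < β.re)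
    {C : HalfLineL2 →L[ℂ] HalfLineL2}
    (hC : IsWeightedComp C (dilationWeight a β) (fun s => a⁻¹ * s)) {μ : ℂ} (hμ0 : 0 < ‖μ‖)
    (hμ : ‖μ‖ < a ^ (-(1 / 2) : ℝ)) :
    ∃ R V W : HalfLineL2 →L[ℂ] HalfLineL2,
      (C - μ • 1) * R = 1 ∧ (C - μ • 1) * V = 0 ∧ W * V = 1 := by
  have ha : 0 < a := one_pos.trans ha1
  have hκ : 0 < a ^ (-(1 / 2) : ℝ) := Real.rpow_pos_of_pos ha _
  have hκ2 := rpow_neg_half_sq ha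
  set κ := a ^ (-(1 / 2) : ℝ) with hκdef
  obtain ⟨τ₀, hτ₀⟩ := exists_exp_lt κ hβ hμ0
  set τ := max τ₀ 1 with hτdef
  have hτ : 0 < τ := one_pos.trans_le (le_max_right _ _)
  have hττ : τ < a * τ := lt_mul_of_one_lt_left hτ ha1
  obtain ⟨χ, hχ, hχc⟩ := exists_isWeightedComp_indicator_Iio (τ := τ)
  obtain ⟨χ', hχ', hχc'⟩ := exists_isWeightedComp_indicator_Iio (τ := a * τ)
  obtain ⟨D, hD, -⟩ := exists_isWeightedComp_dilation ha (β := 0) (by simp)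
  obtain ⟨D', hD', hDn'⟩ := exists_isWeightedComp_mul (m := fun _ => (a : ℂ)) (K := κ⁻¹) (c := a)
    measurable_const ha (by positivity) (fun s _ => by
      rw [Complex.norm_real, Real.norm_of_nonneg ha.le, inv_pow, hκ2, inv_inv, sq])
  -- Multiplication by `exp (-ωs)` conjugates the weighted dilation to the unweighted one.
  set ω : ℂ := β / ((a - 1 : ℝ) : ℂ) with hω
  have ha1' : ((a - 1 : ℝ) : ℂ) ≠ 0 := Complex.ofReal_ne_zero.2 (sub_pos.2 ha1).ne'
  have hωre : 0 < ω.re := by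
    rw [hω, Complex.div_ofReal_re]
    exact div_pos hβ (sub_pos.2 ha1)
  have hβω : β = ω * (a - 1) := by
    rw [hω, ← Complex.ofReal_one, ← Complex.ofReal_sub, div_mul_cancel₀ _ ha1']
  obtain ⟨M, hM, -⟩ := exists_isWeightedComp_id (m := fun s => Complex.exp (-ω * s)) (K := 1)
    (by fun_prop) zero_le_one (fun s hs => by
      rw [Complex.norm_exp, Real.exp_le_one_iff, Complex.re_mul_ofReal, Complex.neg_re, neg_mul,
        neg_nonpos]
      positivity)
  obtain ⟨M', hM', -⟩ := exists_isWeightedComp_id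
    (m := (Iio (a * τ)).indicator fun s => Complex.exp (ω * s)) (K := Real.exp (ω.re * (a * τ)))
    (Measurable.indicator (by fun_prop) measurableSet_Iio) (Real.exp_pos _).le (fun s hs => by
      by_cases h : s ∈ Iio (a * τ)
      · rw [indicator_of_mem h, Complex.norm_exp, Complex.re_mul_ofReal]
        have h' : s < a * τ := h
        gcongr
      · rw [indicator_of_notMem h, norm_zero]
        positivity)
  obtain ⟨A, B, m, φ, hA, hm, hBA⟩ := exists_compression hτ hττ
  have haC : (a : ℂ) ≠ 0 := Complex.ofReal_ne_zero.2 ha.ne'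
  refine exists_right_inverse_and_kernel (C := C) (D := D) (D' := D') (χ := χ) (χ' := χ') (M := M)
    (M' := M') (A := A) (B := B) (norm_pos_iff.1 hμ0) ?_ ?_ ?_ ?_ ?_ ?_ ?_ ?_ ?_ ?_ ?_ ?_ ?_ ?_ ?_
    hBA
  · refine (hD.mul hD').eq IsWeightedComp.one fun s _ f => ?_
    simp only [dilationWeight, neg_zero, zero_mul, Complex.exp_zero, mul_one, id]
    rw [mul_inv_cancel_left₀ ha.ne', Complex.ofReal_inv, inv_mul_cancel₀ haC]
  · refine (hC.mul hM).eq (hM.mul hD) fun s _ f => ?_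
    simp only [dilationWeight, neg_zero, zero_mul, Complex.exp_zero, mul_one, id]
    rw [mul_assoc _ (Complex.exp _) (Complex.exp _), ← Complex.exp_add,
      mul_comm (Complex.exp (-ω * s))]
    congr 3
    rw [hβω]
    push_cast
    field_simp
    ring
  · refine (hM.mul hM').eq hχ' fun s _ f => ?_
    simp only [id]
    by_cases h : s ∈ Iio (a * τ)
    · rw [indicator_of_mem h, indicator_of_mem h, ← Complex.exp_add]
      simp
    · rw [indicator_of_notMem h, indicator_of_notMem h, mul_zero]
  · refine (hχ'.mul hM').eq hM' fun s _ f => ?_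
    simp only [id]
    by_cases h : s ∈ Iio (a * τ)
    · simp [indicator_of_mem h]
    · simp [indicator_of_notMem h]
  · exact (hχ.mul hM).eq (hM.mul hχ) fun s _ f => by simp only [id, mul_comm]
  · refine (hχ.mul hχ).eq hχ fun s _ f => ?_
    simp only [id]
    by_cases h : s ∈ Iio τ
    · simp [indicator_of_mem h]
    · simp [indicator_of_notMem h]
  · refine (hχ.mul hχ').eq hχ fun s _ f => ?_
    simp only [id]
    by_cases h : s ∈ Iio τ
    · have h' : s ∈ Iio (a * τ) := lt_trans h hττ
      simp [indicator_of_mem h, indicator_of_mem h']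
    · simp [indicator_of_notMem h]
  · refine (hχ'.mul hχ).eq hχ fun s _ f => ?_
    simp only [id]
    by_cases h : s ∈ Iio τ
    · have h' : s ∈ Iio (a * τ) := lt_trans h hττ
      simp [indicator_of_mem h, indicator_of_mem h']
    · simp [indicator_of_notMem h]
  · refine (hD'.mul hχ').eq (hχ.mul hD') fun s _ f => ?_
    simp only [id]
    by_cases h : s ∈ Iio τ
    · have h' : a * s ∈ Iio (a * τ) := mul_lt_mul_of_pos_left h ha
      simp [indicator_of_mem h, indicator_of_mem h']
    · have h' : a * s ∉ Iio (a * τ) := fun h' => h (lt_of_mul_lt_mul_left h' ha.le)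
      simp [indicator_of_notMem h, indicator_of_notMem h']
  · refine (hχ'.mul (hC.mul hχc)).eq (IsWeightedComp.zero id) fun s _ f => ?_
    simp only [id]
    by_cases h : s ∈ Iio (a * τ)
    · have h' : a⁻¹ * s ∉ Ici τ := by
        rw [mem_Ici, not_le, inv_mul_lt_iff₀ ha]
        exact h
      simp [indicator_of_notMem h']
    · simp [indicator_of_notMem h]
  · rw [norm_smul]
    calc ‖μ‖ * ‖D'‖ ≤ ‖μ‖ * κ⁻¹ := by gcongr
      _ < κ * κ⁻¹ := by gcongr
      _ = 1 := mul_inv_cancel₀ hκ.ne'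
  · exact (norm_mul_le_of_isWeightedComp ha hβ hC hχc).trans_lt (hτ₀ τ (le_max_left _ _))
  · refine hχc'.norm_le_of_id (measurable_const.indicator measurableSet_Ici) zero_le_one
      fun s _ => ?_
    by_cases h : s ∈ Ici (a * τ)
    · simp [indicator_of_mem h]
    · simp [indicator_of_notMem h]
  · refine (hχ.mul hA).eq (IsWeightedComp.zero id) fun s _ f => ?_
    simp only [id]
    by_cases h : s ∈ Iio τ
    · rw [hm s fun h' => lt_asymm h h'.1]
      simp
    · simp [indicator_of_notMem h]
  · refine (hχ'.mul hA).eq hA fun s _ f => ?_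
    simp only [id]
    by_cases h : s ∈ Iio (a * τ)
    · simp [indicator_of_mem h]
    · rw [hm s fun h' => h h'.2]
      simp

/-- For `a < 1` there are no eigenvectors. Far from `0` the operator is smaller than any given
`μ ≠ 0`, so an eigenvector vanishes on some `[τ, ∞)`; the eigenvalue equation then propagates this
to `[aⁿτ, ∞)` for all `n`. -/
theorem eq_zero_of_eigenvector {a : ℝ} (ha : 0 < a) (ha1 : a < 1) {β : ℂ} (hβ : 0 < β.re)
    {C : HalfLineL2 →L[ℂ] HalfLineL2}
    (hC : IsWeightedComp C (dilationWeight a β) (fun s => a⁻¹ * s)) {μ : ℂ} {F : HalfLineL2}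
    (hF : C F = μ • F) : F = 0 := by
  have haC : (a : ℂ) ≠ 0 := Complex.ofReal_ne_zero.2 ha.ne'
  rcases eq_or_ne μ 0 with rfl | hμ
  -- For `μ = 0`: undoing the dilation leaves multiplication by a nonvanishing function.
  · obtain ⟨D', hD', -⟩ := exists_isWeightedComp_mul (m := fun _ => (a : ℂ)) (K := √a) (c := a)
      measurable_const ha (Real.sqrt_nonneg a) (fun s _ => by
        rw [Complex.norm_real, Real.norm_of_nonneg ha.le, Real.sq_sqrt ha.le, sq])
    have h1 : (D' * C) F = 0 := by
      change D' (C F) = 0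
      rw [hF, zero_smul, map_zero]
    have h2 := (hD'.mul hC) F F (ae_eq_refl _)
    rw [h1] at h2
    refine (Lp.eq_zero_iff_ae_eq_zero).2 ?_
    filter_upwards [h2, Lp.coeFn_zero ℂ 2 halfLine] with s h3 h4
    rw [h4, inv_mul_cancel_left₀ ha.ne', Pi.zero_apply, zero_eq_mul] at h3
    refine h3.resolve_left ?_
    simp [dilationWeight, haC]
  choose χ _ hQ using fun τ : ℝ => exists_isWeightedComp_indicator_Iio (τ := τ)
  -- `F` vanishes on `[τ, ∞)`.
  set P : ℝ → Prop := fun τ => (1 - χ τ) F = 0 with hP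
  have hcomm : ∀ τ, (1 - χ (a * τ)) * C = C * (1 - χ τ) := fun τ => by
    refine ((hQ _).mul hC).eq (hC.mul (hQ _)) fun s _ f => ?_
    simp only [id]
    by_cases h : s ∈ Ici (a * τ)
    · have h' : a⁻¹ * s ∈ Ici τ := by rw [mem_Ici, le_inv_mul_iff₀ ha]; exact h
      simp [indicator_of_mem h, indicator_of_mem h']
    · have h' : a⁻¹ * s ∉ Ici τ := by rw [mem_Ici, le_inv_mul_iff₀ ha]; exact h
      simp [indicator_of_notMem h, indicator_of_notMem h']
  have heig : ∀ τ, μ • (1 - χ (a * τ)) F = C ((1 - χ τ) F) := fun τ => by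
    rw [← map_smul, ← hF]
    exact congrArg (fun T : HalfLineL2 →L[ℂ] HalfLineL2 => T F) (hcomm τ)
  have hstep : ∀ τ, P τ → P (a * τ) := fun τ h => by
    have := heig τ
    rw [h, map_zero] at this
    exact (smul_eq_zero.1 this).resolve_left hμ
  obtain ⟨τ₀, hτ₀⟩ := exists_exp_lt (a ^ (-(1 / 2) : ℝ)) hβ (norm_pos_iff.2 hμ)
  set τ := max τ₀ 1 with hτdef
  have hτ : 0 < τ := one_pos.trans_le (le_max_right _ _)
  have hbase : P (a * τ) := by
    have h1 : (1 - χ τ) * (1 - χ (a * τ)) = 1 - χ τ := by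
      refine ((hQ _).mul (hQ _)).eq (hQ _) fun s _ f => ?_
      simp only [id]
      by_cases h : s ∈ Ici τ
      · have h' : s ∈ Ici (a * τ) := le_trans (mul_le_of_le_one_left hτ.le ha1.le) h
        simp [indicator_of_mem h, indicator_of_mem h']
      · simp [indicator_of_notMem h]
    have h2 : μ • (1 - χ (a * τ)) F = (C * (1 - χ τ)) ((1 - χ (a * τ)) F) := by
      rw [heig]
      conv_lhs => rw [← h1]
      rfl
    have h3 : ‖μ‖ * ‖(1 - χ (a * τ)) F‖ ≤ ‖C * (1 - χ τ)‖ * ‖(1 - χ (a * τ)) F‖ := by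
      rw [← norm_smul, h2]
      exact ContinuousLinearMap.le_opNorm _ _
    have h4 := (norm_mul_le_of_isWeightedComp ha hβ hC (hQ τ)).trans_lt (hτ₀ τ (le_max_left _ _))
    refine norm_eq_zero.1 ?_
    by_contra h
    have h5 : 0 < ‖(1 - χ (a * τ)) F‖ := lt_of_le_of_ne (norm_nonneg _) (Ne.symm h)
    nlinarith
  have hall : ∀ n : ℕ, P (a ^ n * (a * τ)) := fun n => by
    induction n with
    | zero => simpa using hbase
    | succ n ih => rw [pow_succ', mul_assoc]; exact hstep _ ih
  have hae : ∀ᵐ s ∂halfLine, ∀ n : ℕ, (Ici (a ^ n * (a * τ))).indicator 1 s * F s = 0 := by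
    refine ae_all_iff.2 fun n => ?_
    have h1 := hQ (a ^ n * (a * τ)) F F (ae_eq_refl _)
    rw [hall n] at h1
    filter_upwards [h1, Lp.coeFn_zero ℂ 2 halfLine] with s h2 h3
    rw [id] at h2
    rw [← h2, h3]
    rfl
  refine (Lp.eq_zero_iff_ae_eq_zero).2 ?_
  filter_upwards [hae, ae_restrict_mem measurableSet_Ioi] with s hs hs0
  have hlim : Tendsto (fun n : ℕ => a ^ n * (a * τ)) atTop (𝓝 (0 * (a * τ))) :=
    (tendsto_pow_atTop_nhds_zero_of_lt_one ha.le ha1).mul_const _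
  rw [zero_mul] at hlim
  obtain ⟨n, hn⟩ := (hlim.eventually_lt_const hs0).exists
  have := hs n
  rwa [indicator_of_mem (mem_Ici.2 hn.le), Pi.one_apply, one_mul] at this

/-- For `a < 1` and `0 < |μ| < a^(-1/2)` the operator `C - μ` is not onto: its range is annihilated
by integration against `K(t) = t^z exp (-ωt)`, where `a^z = μ` and `ω = β / (1 - a)`. -/
theorem not_surjective_of_lt_one {a : ℝ} (ha : 0 < a) (ha1 : a < 1) {β : ℂ} (hβ : 0 < β.re)
    {C : HalfLineL2 →L[ℂ] HalfLineL2}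
    (hC : IsWeightedComp C (dilationWeight a β) (fun s => a⁻¹ * s)) {μ : ℂ} (hμ0 : 0 < ‖μ‖)
    (hμ : ‖μ‖ < a ^ (-(1 / 2) : ℝ)) : 
    ¬ Function.Surjective (C - μ • (1 : HalfLineL2 →L[ℂ] HalfLineL2)) := by
  intro hsurj
  have haC : (a : ℂ) ≠ 0 := Complex.ofReal_ne_zero.2 ha.ne'
  have hμ' : μ ≠ 0 := norm_pos_iff.1 hμ0
  have hlog : Real.log a < 0 := Real.log_neg ha ha1
  have hlogC : (Real.log a : ℂ) ≠ 0 := Complex.ofReal_ne_zero.2 hlog.ne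
  set z : ℂ := Complex.log μ / Real.log a with hz
  set ω : ℂ := β / ((1 - a : ℝ) : ℂ) with hω
  have ha1' : ((1 - a : ℝ) : ℂ) ≠ 0 := Complex.ofReal_ne_zero.2 (sub_pos.2 ha1).ne'
  have hωre : 0 < ω.re := by
    rw [hω, Complex.div_ofReal_re]
    exact div_pos hβ (sub_pos.2 ha1)
  have hβω : β = ω * (1 - a) := by
    rw [hω, ← Complex.ofReal_one, ← Complex.ofReal_sub, div_mul_cancel₀ _ ha1']
  have haz : (a : ℂ) ^ z = μ := by
    rw [Complex.cpow_def_of_ne_zero haC, ← Complex.ofReal_log ha.le, hz, mul_div_cancel₀ _ hlogC,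
      Complex.exp_log hμ']
  have hzre : -(1 / 2) < z.re := by
    have h1 : ‖μ‖ = a ^ z.re := by rw [← haz, Complex.norm_cpow_eq_rpow_re_of_pos ha]
    rw [h1] at hμ
    exact (Real.rpow_lt_rpow_left_iff_of_base_lt_one ha ha1).1 hμ
  set K : ℝ → ℂ := fun t => (t : ℂ) ^ z * Complex.exp (-ω * t) with hK
  have hKm : MemLp K 2 halfLine := memLp_cpow_mul_exp hzre hωre
  have hKs : MemLp (star K) 2 halfLine := hKm.star
  obtain ⟨F, hF⟩ := hsurj hKs.toLp
  -- The functional is an eigenvector of the adjoint.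
  have heig : ∫ s in Ioi 0, C F s * K s = μ * ∫ s in Ioi 0, F s * K s := by
    have h1 : ∫ s in Ioi 0, C F s * K s =
        ∫ s in Ioi 0, ((a⁻¹ : ℝ) : ℂ) * (μ * (F (a⁻¹ * s) * K (a⁻¹ * s))) := by
      refine integral_congr_ae ?_
      filter_upwards [hC F F (ae_eq_refl _), ae_restrict_mem measurableSet_Ioi] with s hs hs0
      have hs0 : 0 < s := hs0
      have h2 : K s * Complex.exp (-β * ((a⁻¹ * s : ℝ) : ℂ)) = μ * K (a⁻¹ * s) := by
        have h3 : (s : ℂ) ^ z = μ * ((a⁻¹ * s : ℝ) : ℂ) ^ z := by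
          rw [← haz, ← Complex.mul_cpow_ofReal_nonneg ha.le (by positivity), ← Complex.ofReal_mul,
            mul_inv_cancel_left₀ ha.ne']
        simp only [hK]
        rw [h3, mul_assoc, mul_assoc, ← Complex.exp_add]
        congr 3
        rw [hβω]
        push_cast
        field_simp
        ring
      rw [hs, dilationWeight]
      linear_combination ((a⁻¹ : ℝ) : ℂ) * F (a⁻¹ * s) * h2
    have h2 := integral_comp_mul_left_Ioi (fun t : ℝ => F t * K t) 0 (inv_pos.2 ha)
    rw [mul_zero, inv_inv, Complex.real_smul] at h2
    rw [h1, integral_const_mul, integral_const_mul, h2]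
    push_cast
    field_simp
  have hint : ∀ G : HalfLineL2, Integrable (fun s => G s * K s) halfLine := fun G =>
    (Lp.memLp G).integrable_mul hKm
  have h0 : ∫ s in Ioi 0, (C F - μ • F) s * K s = 0 := by
    have h1 : ∫ s in Ioi 0, (C F - μ • F) s * K s =
        ∫ s in Ioi 0, (C F s * K s - μ * (F s * K s)) := by
      refine integral_congr_ae ?_
      filter_upwards [Lp.coeFn_sub (C F) (μ • F), Lp.coeFn_smul μ F] with s h1 h2
      rw [h1, Pi.sub_apply, h2, Pi.smul_apply, smul_eq_mul]
      ring
    rw [h1, integral_sub (hint _) ((hint _).const_mul _), integral_const_mul, heig, sub_self]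
  have h1 : ∫ s in Ioi 0, ‖K s‖ ^ 2 = 0 := by
    have hF' : C F - μ • F = hKs.toLp := hF
    rw [hF'] at h0
    have h2 : ∫ s in Ioi 0, (hKs.toLp : HalfLineL2) s * K s =
        ∫ s in Ioi 0, ((‖K s‖ ^ 2 : ℝ) : ℂ) := by
      refine integral_congr_ae ?_
      filter_upwards [hKs.coeFn_toLp] with s hs
      rw [hs, Pi.star_apply, RCLike.star_def, Complex.conj_mul']
      push_cast; rfl
    rw [h2, integral_complex_ofReal] at h0
    exact_mod_cast h0
  rw [integral_eq_zero_iff_of_nonneg (fun s => sq_nonneg _) (hKm.integrable_norm_pow two_ne_zero)]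
    at h1
  have h2 : ∀ᵐ s ∂halfLine, False := by
    filter_upwards [h1, ae_restrict_mem measurableSet_Ioi] with s hs hs0
    have hs0 : 0 < s := hs0
    have h3 : K s = 0 := by simpa using hs
    rcases mul_eq_zero.1 h3 with h | h
    · exact (Complex.ofReal_ne_zero.2 hs0.ne') ((Complex.cpow_eq_zero_iff _ _).1 h).1
    · exact Complex.exp_ne_zero _ h
  rw [eventually_false_iff_eq_bot, ae_eq_bot, Measure.restrict_eq_zero] at h2
  simp at h2

/-! ### The composition operator on the Hardy space -/

theorem exists_right_inverse_and_kernel_compOp {a : ℝ} {b : ℂ} (ha : 0 < a) (ha1 : 1 < a)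
    (hb : 0 < b.re) {μ : ℂ} (hμ0 : 0 < ‖μ‖) (hμ : ‖μ‖ < a ^ (-(1 / 2) : ℝ)) :
    ∃ R V W : HardyH2 →L[ℂ] HardyH2, (HardyH2.compOp a b ha hb.le - μ • 1) * R = 1 ∧
      (HardyH2.compOp a b ha hb.le - μ • 1) * V = 0 ∧ W * V = 1 := by
  obtain ⟨T, hT, hTC⟩ := exists_laplaceEquiv_compOp a b ha hb.le
  obtain ⟨R, V, W, hR, hV, hW⟩ :=
    exists_right_inverse_and_kernel_of_one_lt ha1 (two_pi_mul_re_pos hb) hT hμ0 hμ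
  let Φ := laplaceEquiv.toContinuousLinearEquiv.conjContinuousAlgEquiv
  have hΦT : Φ T = HardyH2.compOp a b ha hb.le := by
    refine ContinuousLinearMap.ext fun f => ?_
    change laplaceEquiv (T (laplaceEquiv.symm f)) = _
    rw [hTC, LinearIsometryEquiv.apply_symm_apply]
  have hU : Φ (T - μ • 1) = HardyH2.compOp a b ha hb.le - μ • 1 := by
    rw [map_sub, map_smul, map_one, hΦT]
  refine ⟨Φ R, Φ V, Φ W, ?_, ?_, ?_⟩
  · rw [← hU, ← map_mul, hR, map_one]
  · rw [← hU, ← map_mul, hV, map_zero]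
  · rw [← map_mul, hW, map_one]

theorem norm_compOp_le {a : ℝ} {b : ℂ} (ha : 0 < a) (hb : 0 ≤ b.re) :
    ‖HardyH2.compOp a b ha hb‖ ≤ a ^ (-(1 / 2) : ℝ) := by
  refine (LinearMap.mkContinuous_norm_le _ ENNReal.toReal_nonneg _).trans_eq ?_
  rw [← ENNReal.toReal_rpow, ENNReal.toReal_ofReal (inv_pos.2 ha).le, Real.inv_rpow ha.le,
    Real.rpow_neg ha.le]

instance nontrivial_hardyH2 : Nontrivial HardyH2 := by
  have h1 : halfLine (Ioo (0 : ℝ) 1) = 1 := by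
    rw [Measure.restrict_apply measurableSet_Ioo, inter_eq_left.2 Ioo_subset_Ioi_self]
    simp
  have hne : ∃ F : HalfLineL2, F ≠ 0 := by
    refine ⟨indicatorConstLp 2 (measurableSet_Ioo (a := (0 : ℝ)) (b := 1))
      (by rw [h1]; exact ENNReal.one_ne_top) 1, fun h => ?_⟩
    have := congrArg norm h
    rw [norm_indicatorConstLp (by norm_num) (by norm_num), norm_zero] at this
    simp [measureReal_def, h1] at this
  obtain ⟨F, hF⟩ := hne
  exact ⟨laplaceEquiv F, 0, fun h => hF (laplaceEquiv.map_eq_zero_iff.1 h)⟩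

theorem mem_pointSpectrum_compOp {a : ℝ} {b : ℂ} (ha : 0 < a) (ha1 : 1 < a) (hb : 0 < b.re) {μ : ℂ}
    (hμ0 : 0 < ‖μ‖) (hμ : ‖μ‖ < a ^ (-(1 / 2) : ℝ)) :
    μ ∈ pointSpectrum (HardyH2.compOp a b ha hb.le) := by
  obtain ⟨-, V, W, -, hV, hW⟩ := exists_right_inverse_and_kernel_compOp ha ha1 hb hμ0 hμ
  obtain ⟨f, hf⟩ := exists_ne (0 : HardyH2)
  refine ⟨V f, fun h => hf ?_, ?_⟩
  · have : W (V f) = f := congrArg (fun A : HardyH2 →L[ℂ] HardyH2 => A f) hW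
    rw [← this, h, map_zero]
  · exact sub_eq_zero.1 (congrArg (fun A : HardyH2 →L[ℂ] HardyH2 => A f) hV)

theorem pointSpectrum_subset_spectrum {E : Type*} [NormedAddCommGroup E] [NormedSpace ℂ E]
    (U : E →L[ℂ] E) : pointSpectrum U ⊆ spectrum ℂ U := by
  rintro μ ⟨x, hx, hUx⟩ hunit
  obtain ⟨S, hS⟩ := hunit.exists_left_inv
  refine hx ?_
  have h1 : S ((algebraMap ℂ (E →L[ℂ] E) μ - U) x) = x :=
    congrArg (fun A : E →L[ℂ] E => A x) hS
  have h2 : (algebraMap ℂ (E →L[ℂ] E) μ - U) x = 0 := by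
    rw [Algebra.algebraMap_eq_smul_one]
    change μ • x - U x = 0
    rw [hUx, sub_self]
  rw [← h1, h2, map_zero]

theorem pointSpectrum_compOp_eq_empty {a : ℝ} {b : ℂ} (ha : 0 < a) (ha1 : a < 1)
    (hb : 0 < b.re) : pointSpectrum (HardyH2.compOp a b ha hb.le) = ∅ := by
  obtain ⟨T, hT, hTC⟩ := exists_laplaceEquiv_compOp a b ha hb.le
  refine eq_empty_of_forall_notMem ?_
  rintro μ ⟨f, hf, hCf⟩
  obtain ⟨F, rfl⟩ := laplaceEquiv.surjective f
  rw [← hTC, ← map_smul] at hCf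
  have := eq_zero_of_eigenvector ha ha1 (two_pi_mul_re_pos hb) hT (laplaceEquiv.injective hCf)
  exact hf (by rw [this, map_zero])

/-- A universal operator on a nonzero space has nonzero kernel, as it contains a copy of the zero
operator. -/
theorem exists_ne_zero_of_isUniversalOperator {E : Type*} [NormedAddCommGroup E]
    [NormedSpace ℂ E] [Nontrivial E] {U : E →L[ℂ] E} (hU : IsUniversalOperator U) :
    ∃ x, x ≠ 0 ∧ U x = 0 := by
  obtain ⟨α, -, M, -, -, e, he⟩ := hU 0
  obtain ⟨x, hx⟩ := exists_ne (0 : E)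
  refine ⟨e x, fun h => hx ?_, ?_⟩
  · exact e.map_eq_zero_iff.1 (Subtype.ext h)
  · rw [he x, smul_zero]
    simp

theorem mem_spectrum_compOp_of_lt_one {a : ℝ} {b : ℂ} (ha : 0 < a) (ha1 : a < 1) (hb : 0 < b.re)
    {μ : ℂ} (hμ0 : 0 < ‖μ‖) (hμ : ‖μ‖ < a ^ (-(1 / 2) : ℝ)) :
    μ ∈ spectrum ℂ (HardyH2.compOp a b ha hb.le) := by
  obtain ⟨T, hT, hTC⟩ := exists_laplaceEquiv_compOp a b ha hb.le
  intro hunit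
  refine not_surjective_of_lt_one ha ha1 (two_pi_mul_re_pos hb) hT hμ0 hμ fun G => ?_
  obtain ⟨S, hS⟩ := hunit.exists_right_inv
  obtain ⟨F, hF⟩ := laplaceEquiv.surjective (-S (laplaceEquiv G))
  refine ⟨F, laplaceEquiv.injective ?_⟩
  have h1 : (algebraMap ℂ (HardyH2 →L[ℂ] HardyH2) μ - HardyH2.compOp a b ha hb.le)
      (S (laplaceEquiv G)) = laplaceEquiv G :=
    congrArg (fun A : HardyH2 →L[ℂ] HardyH2 => A (laplaceEquiv G)) hS
  rw [Algebra.algebraMap_eq_smul_one] at h1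
  change μ • S (laplaceEquiv G) - HardyH2.compOp a b ha hb.le (S (laplaceEquiv G)) = _ at h1
  change laplaceEquiv (T F - μ • F) = _
  rw [map_sub, map_smul, hTC, hF, map_neg, smul_neg, sub_neg_eq_add, neg_add_eq_sub]
  exact h1

theorem closedBall_subset_of_isClosed {s : Set ℂ} (hs : IsClosed s) {r : ℝ} (hr : 0 < r)
    (h : ∀ μ : ℂ, 0 < ‖μ‖ → ‖μ‖ < r → μ ∈ s) : Metric.closedBall 0 r ⊆ s := by
  have h1 : Metric.ball (0 : ℂ) r ∩ {0}ᶜ ⊆ s := fun μ hμ =>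
    h μ (norm_pos_iff.2 hμ.2) (by simpa using hμ.1)
  have h2 : Metric.ball (0 : ℂ) r ⊆ closure (Metric.ball (0 : ℂ) r ∩ {0}ᶜ) :=
    (dense_compl_singleton (0 : ℂ)).open_subset_closure_inter Metric.isOpen_ball
  rw [← closure_ball (0 : ℂ) hr.ne']
  exact closure_minimal (h2.trans (closure_minimal h1 hs)) hs

theorem spectrum_compOp {a : ℝ} {b : ℂ} (ha : 0 < a) (ha1 : a ≠ 1) (hb : 0 < b.re) :
    spectrum ℂ (HardyH2.compOp a b ha hb.le) = {μ : ℂ | ‖μ‖ ≤ a ^ (-(1 / 2) : ℝ)} := by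
  have hball : {μ : ℂ | ‖μ‖ ≤ a ^ (-(1 / 2) : ℝ)} =
      Metric.closedBall 0 (a ^ (-(1 / 2) : ℝ)) := by
    ext μ; simp
  rw [hball]
  refine subset_antisymm ((spectrum.subset_closedBall_norm _).trans
    (Metric.closedBall_subset_closedBall (norm_compOp_le ha hb.le)))
    (closedBall_subset_of_isClosed (spectrum.isClosed _) (Real.rpow_pos_of_pos ha _)
      fun μ hμ0 hμ => ?_)
  rcases ha1.lt_or_gt with h | h
  · exact mem_spectrum_compOp_of_lt_one ha h hb hμ0 hμ
  · exact pointSpectrum_subset_spectrum _ (mem_pointSpectrum_compOp ha h hb hμ0 hμ)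

end PaleyWiener

theorem mainTheorem3 (a : ℝ) (b : ℂ) (ha : 0 < a) (ha1 : a ≠ 1) (hb : 0 < b.re) :
    (1 < a → ∀ μ : ℂ, 0 < ‖μ‖ → ‖μ‖ < a ^ (-(1 / 2) : ℝ) →
      IsUniversalOperator
        (HardyH2.compOp a b ha hb.le - μ • ContinuousLinearMap.id ℂ HardyH2)) ∧
    (a < 1 → ∀ μ : ℂ,
      ¬ IsUniversalOperator
        (HardyH2.compOp a b ha hb.le - μ • ContinuousLinearMap.id ℂ HardyH2)) ∧
    (1 < a → {μ : ℂ | 0 < ‖μ‖ ∧ ‖μ‖ < a ^ (-(1 / 2) : ℝ)} ⊆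
      pointSpectrum (HardyH2.compOp a b ha hb.le)) ∧
    (a < 1 → pointSpectrum (HardyH2.compOp a b ha hb.le) = ∅) ∧
    spectrum ℂ (HardyH2.compOp a b ha hb.le) = {μ : ℂ | ‖μ‖ ≤ a ^ (-(1 / 2) : ℝ)} := by
  refine ⟨fun h μ hμ0 hμ => ?_, fun h μ hU => ?_, fun h μ hμ => ?_, fun h => ?_, ?_⟩
  · obtain ⟨R, V, W, hR, hV, hW⟩ :=
      PaleyWiener.exists_right_inverse_and_kernel_compOp ha h hb hμ0 hμ
    exact PaleyWiener.isUniversalOperator_of_right_inverse hR hV hW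
  · obtain ⟨f, hf, hUf⟩ := PaleyWiener.exists_ne_zero_of_isUniversalOperator hU
    have hmem : μ ∈ pointSpectrum (HardyH2.compOp a b ha hb.le) := ⟨f, hf, sub_eq_zero.1 hUf⟩
    rw [PaleyWiener.pointSpectrum_compOp_eq_empty ha h hb] at hmem
    exact hmem
  · exact PaleyWiener.mem_pointSpectrum_compOp ha h hb hμ.1 hμ.2
  · exact PaleyWiener.pointSpectrum_compOp_eq_empty ha h hb
  · exact PaleyWiener.spectrum_compOp ha ha1 hb
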